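/- Fix $h,g\in\mathbb{C}$. Let $H=GL_{h,g}(2)$ be the Hopf algebra over $\mathbb{C}$ generated by $a,b,c,d,\mathcal{D}^{-1}$ with relations $$ca=ac-gc^2,\quad cd=dc-hc^2,\quad db=bd+g(\mathcal{D}-d^2),\quad ab=ba+h(\mathcal{D}-a^2),$$ $$cb=bc-hac-gdc+ghc^2,\quad da=ad+hac-gdc,\quad \mathcal{D}\mathcal{D}^{-1}=\mathcal{D}^{-1}\mathcal{D}=1,\qquad \mathcal{D}:=ad-bc+hac,$$ matrix coproduct and counit on $T=\begin{pmatrix}a&b\\c&d\end{pmatrix}$ ($\Delta(T_{ij})=\sum_kT_{ik}\otimes T_{kj}$, $\varepsilon(T_{ij})=\delta_{ij}$, $\mathcal D^{-1}$ group-like) and antipode $S(a)=\mathcal{D}^{-1}(d+gc)$, $S(b)=\mathcal{D}^{-1}(gd-ga-b+g^2c)$, $S(c)=-\mathcal{D}^{-1}c$, $S(d)=\mathcal{D}^{-1}(a-gc)$, $S(\mathcal{D}^{-1})=\mathcal{D}$. **Calculi.** Let $A,B,C,D\in M_4(\mathbb{C})$ be the matrices of one of the three families below. There is a representation $f=(f_{ij}):H\to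 M_4(\mathbb{C})$ with $f(a)=A$, $f(b)=B$, $f(c)=C$, $f(d)=D$, and $\Gamma$ denotes the first order differential calculus that is free as a left $H$-module on left-invariant forms $\theta_1,\dots,\theta_4$, with $\theta_i x=\sum_j x_{(1)}f_{ij}(x_{(2)})\,\theta_j$ and $dT=T\begin{pmatrix}\theta_1&\theta_2\\\theta_3&\theta_4\end{pmatrix}$. $\Gamma_1$ ($z\in\mathbb{C}$, $z\neq-1$): $$A=\begin{pmatrix}\frac{3z+2}{2}&0&\frac{-(3h+g)z-2h}{2}&\frac{-z}{2}\\h(z+1)&z+1&-h^2(z+1)&-h(z+1)\\0&0&z+1&0\\\frac z2&0&\frac{(h-g)z+2h}{2}&\frac{z+2}{2}\end{pmatrix},\quad B=\begin{pmatrix}0&z&h(h+g)(z+1)&0\\0&(h+g)(z+1)&-hg(h+g)(z+1)&0\\0&0&-(h+g)(z+1)&0\\0&z&g(h+g)(z+1)&0\end{pmatrix},$$ $$C=\begin{pmatrix}0&0&z&0\\0&0&0&0\\0&0&0&0\\0&0&z&0\end{pmatrix},\quad D=\begin{pmatrix}\frac{z+2}{2}&0&\frac{-(h-g)z+2g}{2}&\frac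 z2\\-g(z+1)&z+1&-g^2(z+1)&g(z+1)\\0&0&z+1&0\\\frac{-z}{2}&0&\frac{-(h+3g)z-2g}{2}&\frac{3z+2}{2}\end{pmatrix}.$$ $\Gamma_2$ ($z\in\mathbb{C}$ arbitrary): $$A=\begin{pmatrix}\frac{z+2}{2}&0&\frac{(h+g)z-2h}{2}&\frac z2\\h(z+1)&1&h((h+g)z-h)&h(z-1)\\0&0&1&0\\\frac{-z}{2}&0&\frac{-(h+g)z+2h}{2}&\frac{-z+2}{2}\end{pmatrix},\quad B=\begin{pmatrix}-hz&0&h(h+g)(1-z)&-hz\\hgz&h+g&hg(h+g)(z-1)&ghz\\z&0&(h+g)(z-1)&z\\-gz&0&g(h+g)(1-z)&-gz\end{pmatrix},$$ $$C=\begin{pmatrix}0&0&0&0\\z&0&(h+g)z&z\\0&0&0&0\\0&0&0&0\end{pmatrix},\quad D=\begin{pmatrix}\frac{-z+2}{2}&0&\frac{-(h+g)z+2g}{2}&\frac{-z}{2}\\g(z-1)&1&g((h+g)z-g)&g(z+1)\\0&0&1&0\\\frac z2&0&\frac{(h+g)z-2g}{2}&\frac{z+2}{2}\end{pmatrix}.$$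 $\Gamma_3$ ($z\in\mathbb{C}$, $z\neq-1$): $$A=\begin{pmatrix}\frac{z+2}{2}&0&\frac{(h+g)z-2h}{2}&\frac z2\\h&1&-h^2&-h\\0&0&1&0\\\frac z2&0&\frac{(h+g)z+2h}{2}&\frac{z+2}{2}\end{pmatrix},\quad B=\begin{pmatrix}0&0&h(h+g)&0\\0&h+g&-hg(h+g)&0\\0&0&-(h+g)&0\\0&0&g(h+g)&0\end{pmatrix},$$ $$C=0,\quad D=\begin{pmatrix}\frac{z+2}{2}&0&\frac{(h+g)z+2g}{2}&\frac z2\\-g&1&-g^2&g\\0&0&1&0\\\frac z2&0&\frac{(h+g)z-2g}{2}&\frac{z+2}{2}\end{pmatrix}.$$ **Quantum Lie algebras.** For $\Gamma=\Gamma_n$ let $P(\omega)=S(\omega_{(-1)})\omega_{(0)}$ be the projection onto left-invariant forms, $\mathcal{R}=\{x\in\ker\varepsilon: P(dx)=0\}$, and let $\mathcal{L}_n=(\ker\varepsilon/\mathcal{R})^*$, regarded as the space of functionals on $H$ vanishing at $1$ and on $\mathcal{R}$. It has the basis $\chi_1,\dots,\chi_4$ dual to $\theta_1,\dots,\theta_4$,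 that is, $P(dx)=\sum_j\chi_j(x)\theta_j$. Let $[\varphi,\psi](x)=\varphi(x_{(2)})\,\psi(S(x_{(1)})x_{(3)})$, let $$V=(v_{ij})=\begin{pmatrix}S(a)a&S(a)b&S(c)a&S(c)b\\S(a)c&S(a)d&S(c)c&S(c)d\\S(b)a&S(b)b&S(d)a&S(d)b\\S(b)c&S(b)d&S(d)c&S(d)d\end{pmatrix}$$ be the matrix of the right coaction on the $\theta_i$, and put $\Lambda_{ik,st}=f_{it}(v_{sk})$ and $\mathcal{C}_{ik,j}=[\chi_i,\chi_k](a_j)$ with $(a_1,a_2,a_3,a_4)=(a-1,b,c,d-1)$, so that $\mathcal{C}_{ik,j}$ is the coefficient of $\chi_j$ in $[\chi_i,\chi_k]$. The universal enveloping algebra $U(\mathcal{L}_n)$ is the quotient of the tensor algebra of $\mathcal{L}_n$ by the relations $$\chi_i\chi_k=\sum_{s,t}\Lambda_{st,ik}\,\chi_s\chi_t+\sum_j\mathcal{C}_{ik,j}\,\chi_j\qquad(1\le i,k\le4).$$ **Theorem.** (1) For every $z\ne-1$, $U(\mathcal{L}_1)$ is the unital algebra generated by $\chi_1,\chi_2,\chi_3,\chi_4$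 with defining relations $$\chi_3\chi_4=\tfrac{z(h+g)}{z+1}\chi_1^2+(h+g)^2\chi_2\chi_1-(h+g)\chi_2\chi_3+\tfrac{z(h+g)}{z+1}\chi_1\chi_4-\tfrac{z}{z+1}\chi_1\chi_3+\tfrac1{z+1}\chi_4\chi_3+\tfrac{h+g}{z+1}\chi_1-\tfrac1{z+1}\chi_3,$$ $$\chi_3\chi_1=-\tfrac{z(h+g)}{z+1}\chi_1^2-(h+g)^2\chi_2\chi_1+(h+g)\chi_2\chi_3-\tfrac{z(h+g)}{z+1}\chi_1\chi_4+\tfrac{2z+1}{z+1}\chi_1\chi_3+\tfrac{z}{z+1}\chi_4\chi_3-\tfrac{h+g}{z+1}\chi_1+\tfrac1{z+1}\chi_3,$$ $$\chi_3\chi_2=\tfrac{z}{z+1}\chi_4^2-\tfrac{z}{z+1}\chi_1^2-(h+g)^2\chi_2^2-\tfrac{(2z+1)(h+g)}{z+1}\chi_2\chi_1+\tfrac{h+g}{z+1}\chi_2\chi_4+\chi_2\chi_3-\tfrac1{z+1}\chi_1-\tfrac{h+g}{z+1}\chi_2+\tfrac1{z+1}\chi_4,$$ $$\chi_4\chi_1=\chi_1\chi_4,\qquad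 \chi_4\chi_2=-(h+g)\chi_2^2-\tfrac{z}{z+1}\chi_2\chi_1+\tfrac1{z+1}\chi_2\chi_4-\tfrac1{z+1}\chi_2,$$ $$\chi_1\chi_2=(h+g)\chi_2^2+\tfrac{2z+1}{z+1}\chi_2\chi_1+\tfrac{z}{z+1}\chi_2\chi_4+\tfrac1{z+1}\chi_2.$$ (2) For every $z$ in the case of $\mathcal{L}_2$, and for every $z\neq-1$ in the case of $\mathcal{L}_3$, $U(\mathcal{L}_2)$ and $U(\mathcal{L}_3)$ are the unital algebras generated by $\chi_1,\chi_2,\chi_3,\chi_4$ with defining relations $$\chi_3\chi_4=(h+g)^2\chi_2\chi_1-(h+g)\chi_2\chi_3+\chi_4\chi_3+(h+g)\chi_1-\chi_3,$$ $$\chi_3\chi_1=-(h+g)^2\chi_2\chi_1+(h+g)\chi_2\chi_3+\chi_1\chi_3-(h+g)\chi_1+\chi_3,$$ $$\chi_3\chi_2=-(h+g)^2\chi_2^2-(h+g)\chi_2\chi_1+(h+g)\chi_2\chi_4+\chi_2\chi_3-\chi_1-(h+g)\chi_2+\chi_4,$$ $$\chi_4\chi_1=\chi_1\chi_4,\qquad\chi_4\chi_2=-(h+g)\chi_2^2+\chi_2\chi_4-\chi_2,\qquad\chi_1\chi_2=(h+g)\chi_2^2+\chi_2\chi_1+\chi_2.$$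 These relations are equivalent, in any algebra, to those of (1) with $z=0$. (3) In each case $\{\chi_2^{\alpha}\chi_1^{\beta}\chi_4^{\gamma}\chi_3^{\delta}:\alpha,\beta,\gamma,\delta\in\mathbb{Z}_{\ge0}\}$ is a vector space basis of the enveloping algebra. -/

import Mathlib

noncomputable section

namespace Jordanian

open scoped TensorProduct

/-- The defining relations of `GL_{h,g}(2)`, for elements `a, b, c, d` (the entries of the quantum
matrix) and `e` (the inverse of the quantum determinant `a d - b c + h a c`) of an algebra. -/
structure IsQuantumMatrix (h g : ℂ) {B : Type*} [Ring B] [Algebra ℂ B] (a b c d e : B) :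
    Prop where
  ca : c * a = a * c - g • (c * c)
  cd : c * d = d * c - h • (c * c)
  db : d * b = b * d + g • (a * d - b * c + h • (a * c) - d * d)
  ab : a * b = b * a + h • (a * d - b * c + h • (a * c) - a * a)
  cb : c * b = b * c - h • (a * c) - g • (d * c) + (g * h) • (c * c)
  da : d * a = a * d + h • (a * c) - g • (d * c)
  det_inv : (a * d - b * c + h • (a * c)) * e = 1
  inv_det : e * (a * d - b * c + h • (a * c)) = 1

/-- Names of the generators of `GL_{h,g}(2)`. -/
inductive Gen
  | a | b | c | d | detInv

/-- A generator as an element of the free algebra. -/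
def word (x : Gen) : FreeAlgebra ℂ Gen := FreeAlgebra.ι ℂ x

/-- The relations of `GL_{h,g}(2)` in the free algebra on the generators. -/
inductive GLRel (h g : ℂ) : FreeAlgebra ℂ Gen → FreeAlgebra ℂ Gen → Prop
  | ca : GLRel h g (word .c * word .a) (word .a * word .c - g • (word .c * word .c))
  | cd : GLRel h g (word .c * word .d) (word .d * word .c - h • (word .c * word .c))
  | db : GLRel h g (word .d * word .b) (word .b * word .d +
      g • (word .a * word .d - word .b * word .c + h • (word .a * word .c) - word .d * word .d))
  | ab : GLRel h g (word .a * word .b) (word .b * word .a +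
      h • (word .a * word .d - word .b * word .c + h • (word .a * word .c) - word .a * word .a))
  | cb : GLRel h g (word .c * word .b) (word .b * word .c - h • (word .a * word .c) -
      g • (word .d * word .c) + (g * h) • (word .c * word .c))
  | da : GLRel h g (word .d * word .a) (word .a * word .d + h • (word .a * word .c) -
      g • (word .d * word .c))
  | det_inv : GLRel h g
      ((word .a * word .d - word .b * word .c + h • (word .a * word .c)) * word .detInv) 1
  | inv_det : GLRel h g
      (word .detInv * (word .a * word .d - word .b * word .c + h • (word .a * word .c))) 1

/-- The (coordinate algebra of the) two-parameter Jordanian quantum group `GL_{h,g}(2)`. -/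
def JGL (h g : ℂ) : Type := RingQuot (GLRel h g)

namespace JGL

variable {h g : ℂ}

instance : Ring (JGL h g) := inferInstanceAs (Ring (RingQuot (GLRel h g)))
instance : Algebra ℂ (JGL h g) := inferInstanceAs (Algebra ℂ (RingQuot (GLRel h g)))

variable (h g) in
/-- The generators of `GL_{h,g}(2)` as elements of the algebra. -/
def gen (x : Gen) : JGL h g := RingQuot.mkAlgHom ℂ (GLRel h g) (FreeAlgebra.ι ℂ x)

lemma isQuantumMatrix :
    IsQuantumMatrix h g (gen h g .a) (gen h g .b) (gen h g .c) (gen h g .d) (gen h g .detInv) := by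
  constructor
  · simpa [gen, word] using! RingQuot.mkAlgHom_rel ℂ (GLRel.ca (h := h) (g := g))
  · simpa [gen, word] using! RingQuot.mkAlgHom_rel ℂ (GLRel.cd (h := h) (g := g))
  · simpa [gen, word] using! RingQuot.mkAlgHom_rel ℂ (GLRel.db (h := h) (g := g))
  · simpa [gen, word] using! RingQuot.mkAlgHom_rel ℂ (GLRel.ab (h := h) (g := g))
  · simpa [gen, word] using! RingQuot.mkAlgHom_rel ℂ (GLRel.cb (h := h) (g := g))
  · simpa [gen, word] using! RingQuot.mkAlgHom_rel ℂ (GLRel.da (h := h) (g := g))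
  · simpa [gen, word] using! RingQuot.mkAlgHom_rel ℂ (GLRel.det_inv (h := h) (g := g))
  · simpa [gen, word] using! RingQuot.mkAlgHom_rel ℂ (GLRel.inv_det (h := h) (g := g))

/-- The values of an algebra map on the five generators. -/
def genValue {B : Type*} (a b c d e : B) : Gen → B
  | .a => a
  | .b => b
  | .c => c
  | .d => d
  | .detInv => e

/-- The universal property of `GL_{h,g}(2)`. -/
def lift {B : Type*} [Ring B] [Algebra ℂ B] {a b c d e : B}
    (H : IsQuantumMatrix h g a b c d e) : JGL h g →ₐ[ℂ] B :=
  RingQuot.liftAlgHom ℂ ⟨FreeAlgebra.lift ℂ (genValue a b c d e), by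
    rintro _ _ (_ | _ | _ | _ | _ | _ | _ | _)
    · simpa [genValue, word] using H.ca
    · simpa [genValue, word] using H.cd
    · simpa [genValue, word] using H.db
    · simpa [genValue, word] using H.ab
    · simpa [genValue, word] using H.cb
    · simpa [genValue, word] using H.da
    · simpa [genValue, word] using H.det_inv
    · simpa [genValue, word] using H.inv_det⟩

lemma lift_gen {B : Type*} [Ring B] [Algebra ℂ B] {a b c d e : B}
    (H : IsQuantumMatrix h g a b c d e) (x : Gen) :
    lift H (gen h g x) = genValue a b c d e x := by
  unfold lift gen
  refine (RingQuot.liftAlgHom_mkAlgHom_apply _ _ _ _).trans ?_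
  simp

lemma algHom_ext {B : Type*} [Ring B] [Algebra ℂ B] {φ ψ : JGL h g →ₐ[ℂ] B}
    (H : ∀ x, φ (gen h g x) = ψ (gen h g x)) : φ = ψ := by
  refine RingQuot.ringQuot_ext' (S := ℂ) (s := GLRel h g) φ ψ ?_
  exact FreeAlgebra.hom_ext (funext H)

lemma induction {p : JGL h g → Prop} (hgen : ∀ x, p (gen h g x))
    (halg : ∀ r : ℂ, p (algebraMap ℂ _ r)) (hmul : ∀ x y, p x → p y → p (x * y))
    (hadd : ∀ x y, p x → p y → p (x + y)) (x : JGL h g) : p x := by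
  obtain ⟨y, rfl⟩ := RingQuot.mkAlgHom_surjective ℂ (GLRel h g) x
  induction y using FreeAlgebra.induction with
  | grade0 r => simpa using! halg r
  | grade1 r => exact hgen r
  | mul _ _ h1 h2 => simpa using! hmul _ _ h1 h2
  | add _ _ h1 h2 => simpa using! hadd _ _ h1 h2


section Rules

variable {B : Type*} [Ring B] [Algebra ℂ B] {a b c d e : B}

set_option linter.unusedSimpArgs false in
lemma det_comm (H : IsQuantumMatrix h g a b c d e) :
    (a * d - b * c + h • (a * c)) * a =
        (a + (h - g) • c) * (a * d - b * c + h • (a * c)) ∧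
      (a * d - b * c + h • (a * c)) * b =
        (b + (h - g) • (d - a - (h - g) • c)) * (a * d - b * c + h • (a * c)) ∧
      (a * d - b * c + h • (a * c)) * c = c * (a * d - b * c + h • (a * c)) ∧
      (a * d - b * c + h • (a * c)) * d =
        (d - (h - g) • c) * (a * d - b * c + h • (a * c)) := by
  have ca' : ∀ x, c * (a * x) = _ := fun x => by rw [← mul_assoc, H.ca]
  have cd' : ∀ x, c * (d * x) = _ := fun x => by rw [← mul_assoc, H.cd]
  have db' : ∀ x, d * (b * x) = _ := fun x => by rw [← mul_assoc, H.db]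
  have ab' : ∀ x, a * (b * x) = _ := fun x => by rw [← mul_assoc, H.ab]
  have cb' : ∀ x, c * (b * x) = _ := fun x => by rw [← mul_assoc, H.cb]
  have da' : ∀ x, d * (a * x) = _ := fun x => by rw [← mul_assoc, H.da]
  refine ⟨?_, ?_, ?_, ?_⟩ <;>
  · simp only [mul_add, add_mul, mul_sub, sub_mul, mul_assoc, H.ca, H.cd, H.db, H.ab, H.cb, H.da,
    ca', cd', db', ab', cb', da', smul_mul_assoc, mul_smul_comm, smul_add, smul_sub]
    module

lemma mul_detInv (H : IsQuantumMatrix h g a b c d e) :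
    a * e = e * a + (h - g) • (e * c) ∧
      b * e = e * b + (h - g) • (e * d - e * a - (h - g) • (e * c)) ∧
      c * e = e * c ∧ d * e = e * d - (h - g) • (e * c) := by
  obtain ⟨ha, hb, hc, hd⟩ := det_comm H
  set D := a * d - b * c + h • (a * c) with hD
  have key : ∀ x y : B, D * x = y * D → x * e = e * y := fun x y hxy => by
    calc x * e = e * D * x * e := by rw [hD, H.inv_det, one_mul]
      _ = e * (D * x) * e := by simp only [mul_assoc]
      _ = e * y * (D * e) := by rw [hxy]; simp only [mul_assoc]
      _ = e * y := by rw [hD, H.det_inv, mul_one]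
  refine ⟨?_, ?_, ?_, ?_⟩
  · rw [key _ _ ha]; simp [mul_add]
  · rw [key _ _ hb]; simp [mul_add, mul_sub]
  · rw [key _ _ hc]
  · rw [key _ _ hd]; simp [mul_sub]

open TensorProduct in
set_option linter.unusedSimpArgs false in
/-- The coproduct `T ↦ T ⊗ T` respects the relations. -/
lemma comul_aux (H : IsQuantumMatrix h g a b c d e) :
    IsQuantumMatrix h g (B := B ⊗[ℂ] B) (a ⊗ₜ a + b ⊗ₜ c) (a ⊗ₜ b + b ⊗ₜ d)
      (c ⊗ₜ a + d ⊗ₜ c) (c ⊗ₜ b + d ⊗ₜ d) (e ⊗ₜ e) := by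
  have hdet : (a ⊗ₜ[ℂ] a + b ⊗ₜ c) * (c ⊗ₜ b + d ⊗ₜ d) - (a ⊗ₜ b + b ⊗ₜ d) * (c ⊗ₜ a + d ⊗ₜ c) +
      h • ((a ⊗ₜ[ℂ] a + b ⊗ₜ c) * (c ⊗ₜ a + d ⊗ₜ c)) =
      (a * d - b * c + h • (a * c)) ⊗ₜ[ℂ] (a * d - b * c + h • (a * c)) := by
    simp only [mul_add, add_mul, Algebra.TensorProduct.tmul_mul_tmul, H.ca, H.cd, H.db, H.ab,
      H.cb, H.da, TensorProduct.tmul_add, TensorProduct.add_tmul, TensorProduct.tmul_sub,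
      TensorProduct.sub_tmul, TensorProduct.tmul_smul, ← TensorProduct.smul_tmul', smul_add,
      smul_sub]
    module
  constructor
  case det_inv => rw [hdet, Algebra.TensorProduct.tmul_mul_tmul, H.det_inv]; rfl
  case inv_det => rw [hdet, Algebra.TensorProduct.tmul_mul_tmul, H.inv_det]; rfl
  all_goals
    simp only [mul_add, add_mul, Algebra.TensorProduct.tmul_mul_tmul, H.ca, H.cd, H.db, H.ab,
      H.cb, H.da, TensorProduct.tmul_add, TensorProduct.add_tmul, TensorProduct.tmul_sub,
      TensorProduct.sub_tmul, TensorProduct.tmul_smul, ← TensorProduct.smul_tmul', smul_add,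
      smul_sub]
    module

/-- The counit `T ↦ 1` respects the relations. -/
lemma counit_aux (h g : ℂ) : IsQuantumMatrix h g (1 : ℂ) 0 0 1 1 := by
  constructor <;> simp

open MulOpposite in
set_option linter.unusedSimpArgs false in
/-- The antipode respects the relations, as an algebra map to the opposite algebra. -/
lemma antipode_aux (H : IsQuantumMatrix h g a b c d e) :
    IsQuantumMatrix h g (op (e * (d + g • c))) (op (e * (g • d - g • a - b + (g * g) • c)))
      (op (-(e * c))) (op (e * (a - g • c))) (op (a * d - b * c + h • (a * c))) := by
  obtain ⟨ae, be, ce, de⟩ := mul_detInv H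
  have ae' : ∀ x, a * (e * x) = _ := fun x => by rw [← mul_assoc, ae]
  have be' : ∀ x, b * (e * x) = _ := fun x => by rw [← mul_assoc, be]
  have ce' : ∀ x, c * (e * x) = _ := fun x => by rw [← mul_assoc, ce]
  have de' : ∀ x, d * (e * x) = _ := fun x => by rw [← mul_assoc, de]
  have ca' : ∀ x, c * (a * x) = _ := fun x => by rw [← mul_assoc, H.ca]
  have cd' : ∀ x, c * (d * x) = _ := fun x => by rw [← mul_assoc, H.cd]
  have db' : ∀ x, d * (b * x) = _ := fun x => by rw [← mul_assoc, H.db]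
  have ab' : ∀ x, a * (b * x) = _ := fun x => by rw [← mul_assoc, H.ab]
  have cb' : ∀ x, c * (b * x) = _ := fun x => by rw [← mul_assoc, H.cb]
  have da' : ∀ x, d * (a * x) = _ := fun x => by rw [← mul_assoc, H.da]
  have hdet : op (e * (d + g • c)) * op (e * (a - g • c)) -
      op (e * (g • d - g • a - b + (g * g) • c)) * op (-(e * c)) +
      h • (op (e * (d + g • c)) * op (-(e * c))) = op e := by
    have h1 : e * e * (a * d - b * c + h • (a * c)) = e := by rw [mul_assoc, H.inv_det, mul_one]
    apply unop_injective
    rw [unop_op]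
    conv_rhs => rw [← h1]
    simp only [unop_add, unop_sub, unop_mul, unop_op, unop_neg, unop_smul, neg_mul, mul_neg,
      ae, be, ce, de, ae', be', ce', de', mul_add, add_mul, mul_sub, sub_mul, mul_assoc, H.ca, H.cd, H.db, H.ab, H.cb, H.da,
    ca', cd', db', ab', cb', da', smul_mul_assoc, mul_smul_comm, smul_add, smul_sub]
    module
  constructor
  case det_inv => rw [hdet, ← op_mul, H.det_inv, op_one]
  case inv_det => rw [hdet, ← op_mul, H.inv_det, op_one]
  all_goals
    apply unop_injective
    simp only [unop_add, unop_sub, unop_mul, unop_op, unop_neg, unop_smul, neg_mul, mul_neg,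
      ae, be, ce, de, ae', be', ce', de', mul_add, add_mul, mul_sub, sub_mul, mul_assoc, H.ca, H.cd, H.db, H.ab, H.cb, H.da,
    ca', cd', db', ab', cb', da', smul_mul_assoc, mul_smul_comm, smul_add, smul_sub]
    module

set_option linter.unusedSimpArgs false in
/-- `S(T) T = 1` and `T S(T) = 1`. -/
lemma antipode_gen_aux (H : IsQuantumMatrix h g a b c d e) :
    (e * (d + g • c) * a + e * (g • d - g • a - b + (g * g) • c) * c = 1 ∧
      e * (d + g • c) * b + e * (g • d - g • a - b + (g * g) • c) * d = 0 ∧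
      -(e * c) * a + e * (a - g • c) * c = 0 ∧ -(e * c) * b + e * (a - g • c) * d = 1) ∧
    (a * (e * (d + g • c)) + b * -(e * c) = 1 ∧
      a * (e * (g • d - g • a - b + (g * g) • c)) + b * (e * (a - g • c)) = 0 ∧
      c * (e * (d + g • c)) + d * -(e * c) = 0 ∧
      c * (e * (g • d - g • a - b + (g * g) • c)) + d * (e * (a - g • c)) = 1) := by
  obtain ⟨ae, be, ce, de⟩ := mul_detInv H
  have ae' : ∀ x, a * (e * x) = _ := fun x => by rw [← mul_assoc, ae]
  have be' : ∀ x, b * (e * x) = _ := fun x => by rw [← mul_assoc, be]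
  have ce' : ∀ x, c * (e * x) = _ := fun x => by rw [← mul_assoc, ce]
  have de' : ∀ x, d * (e * x) = _ := fun x => by rw [← mul_assoc, de]
  have ca' : ∀ x, c * (a * x) = _ := fun x => by rw [← mul_assoc, H.ca]
  have cd' : ∀ x, c * (d * x) = _ := fun x => by rw [← mul_assoc, H.cd]
  have db' : ∀ x, d * (b * x) = _ := fun x => by rw [← mul_assoc, H.db]
  have ab' : ∀ x, a * (b * x) = _ := fun x => by rw [← mul_assoc, H.ab]
  have cb' : ∀ x, c * (b * x) = _ := fun x => by rw [← mul_assoc, H.cb]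
  have da' : ∀ x, d * (a * x) = _ := fun x => by rw [← mul_assoc, H.da]
  refine ⟨⟨?_, ?_, ?_, ?_⟩, ?_, ?_, ?_, ?_⟩ <;> (try conv_rhs => rw [← H.inv_det]) <;>
  · simp only [neg_mul, mul_neg, ae, be, ce, de, ae', be', ce', de', mul_add, add_mul, mul_sub, sub_mul, mul_assoc, H.ca, H.cd, H.db, H.ab, H.cb, H.da,
    ca', cd', db', ab', cb', da', smul_mul_assoc, mul_smul_comm, smul_add, smul_sub]
    module

end Rules

variable (h g) in
/-- The coproduct of `GL_{h,g}(2)`: `Δ(T) = T ⊗ T` on the quantum matrix `T`, and the inverse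
determinant is group-like. -/
def comulHom : JGL h g →ₐ[ℂ] JGL h g ⊗[ℂ] JGL h g := lift (comul_aux isQuantumMatrix)

variable (h g) in
/-- The counit of `GL_{h,g}(2)`. -/
def counitHom : JGL h g →ₐ[ℂ] ℂ := lift (counit_aux h g)

variable (h g) in
/-- The antipode of `GL_{h,g}(2)`, as an algebra map to the opposite algebra. -/
def antipodeHom : JGL h g →ₐ[ℂ] (JGL h g)ᵐᵒᵖ := lift (antipode_aux isQuantumMatrix)

lemma comulHom_gen (x : Gen) : comulHom h g (gen h g x) = genValue
    (gen h g .a ⊗ₜ gen h g .a + gen h g .b ⊗ₜ gen h g .c)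
    (gen h g .a ⊗ₜ gen h g .b + gen h g .b ⊗ₜ gen h g .d)
    (gen h g .c ⊗ₜ gen h g .a + gen h g .d ⊗ₜ gen h g .c)
    (gen h g .c ⊗ₜ gen h g .b + gen h g .d ⊗ₜ gen h g .d)
    (gen h g .detInv ⊗ₜ gen h g .detInv) x := lift_gen _ x

lemma counitHom_gen (x : Gen) : counitHom h g (gen h g x) = genValue 1 0 0 1 1 x := lift_gen _ x

instance : Bialgebra ℂ (JGL h g) :=
  Bialgebra.ofAlgHom (comulHom h g) (counitHom h g)
    (algHom_ext fun x => by
      cases x <;> simp [comulHom_gen, genValue, TensorProduct.add_tmul, TensorProduct.tmul_add] <;>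
        abel)
    (algHom_ext fun x => by
      cases x <;> simp [comulHom_gen, counitHom_gen, genValue])
    (algHom_ext fun x => by
      cases x <;> simp [comulHom_gen, counitHom_gen, genValue])

lemma comul_gen (x : Gen) : Coalgebra.comul (R := ℂ) (gen h g x) = genValue
    (gen h g .a ⊗ₜ gen h g .a + gen h g .b ⊗ₜ gen h g .c)
    (gen h g .a ⊗ₜ gen h g .b + gen h g .b ⊗ₜ gen h g .d)
    (gen h g .c ⊗ₜ gen h g .a + gen h g .d ⊗ₜ gen h g .c)
    (gen h g .c ⊗ₜ gen h g .b + gen h g .d ⊗ₜ gen h g .d)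
    (gen h g .detInv ⊗ₜ gen h g .detInv) x := comulHom_gen x

lemma counit_gen (x : Gen) :
    Coalgebra.counit (R := ℂ) (gen h g x) = genValue 1 0 0 1 1 x := counitHom_gen x

variable (h g) in
/-- The antipode of `GL_{h,g}(2)`, as a linear map. -/
def antipodeLin : JGL h g →ₗ[ℂ] JGL h g :=
  (MulOpposite.opLinearEquiv ℂ).symm.toLinearMap ∘ₗ (antipodeHom h g).toLinearMap

lemma antipodeLin_gen (x : Gen) : antipodeLin h g (gen h g x) = genValue
    (gen h g .detInv * (gen h g .d + g • gen h g .c))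
    (gen h g .detInv * (g • gen h g .d - g • gen h g .a - gen h g .b + (g * g) • gen h g .c))
    (-(gen h g .detInv * gen h g .c))
    (gen h g .detInv * (gen h g .a - g • gen h g .c))
    (gen h g .a * gen h g .d - gen h g .b * gen h g .c + h • (gen h g .a * gen h g .c)) x := by
  have := lift_gen (antipode_aux (isQuantumMatrix (h := h) (g := g))) x
  simp only [antipodeLin, antipodeHom, LinearMap.comp_apply, AlgHom.toLinearMap_apply, this]
  cases x <;> rfl

lemma antipodeLin_mul (x y : JGL h g) :
    antipodeLin h g (x * y) = antipodeLin h g y * antipodeLin h g x := by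
  simp [antipodeLin]

lemma antipodeLin_one : antipodeLin h g 1 = 1 := by
  simp [antipodeLin]


lemma antipode_left (x : JGL h g) : LinearMap.mul' ℂ (JGL h g)
    ((antipodeLin h g).rTensor (JGL h g) (Coalgebra.comul x)) =
      algebraMap ℂ (JGL h g) (Coalgebra.counit x) := by
  induction x using induction with
  | hgen x =>
    have H := isQuantumMatrix (h := h) (g := g)
    obtain ⟨ha, hb, hc, hd⟩ := (antipode_gen_aux H).1
    cases x <;> simp only [comul_gen, counit_gen, genValue, map_add, LinearMap.rTensor_tmul,
      LinearMap.mul'_apply, antipodeLin_gen, map_one, map_zero]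
    exacts [ha, hb, hc, hd, H.det_inv]
  | halg r => simp [Algebra.algebraMap_eq_smul_one, Algebra.TensorProduct.one_def, antipodeLin_one]
  | hadd x y hx hy => simp [hx, hy]
  | hmul x y hx hy =>
    have key : ∀ u v : JGL h g ⊗[ℂ] JGL h g,
        LinearMap.mul' ℂ (JGL h g) ((antipodeLin h g).rTensor (JGL h g) (u * v)) =
        LinearMap.mul' ℂ (JGL h g) ((antipodeLin h g).rTensor (JGL h g)
          ((1 ⊗ₜ LinearMap.mul' ℂ (JGL h g) ((antipodeLin h g).rTensor (JGL h g) u)) * v)) := by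
      intro u v
      induction u using TensorProduct.induction_on with
      | zero => simp
      | add u u' hu hu' => simp only [add_mul, map_add, TensorProduct.tmul_add, hu, hu']
      | tmul p q =>
        induction v using TensorProduct.induction_on with
        | zero => simp
        | add v v' hv hv' => simp only [mul_add, map_add, hv, hv']
        | tmul p' q' => simp [antipodeLin_mul, mul_assoc]
    have h1 : ∀ r : ℂ, (1 : JGL h g) ⊗ₜ[ℂ] algebraMap ℂ (JGL h g) r =
        r • (1 : JGL h g ⊗[ℂ] JGL h g) := fun r => by
      rw [Algebra.algebraMap_eq_smul_one, TensorProduct.tmul_smul, Algebra.TensorProduct.one_def]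
    rw [Bialgebra.comul_mul, key, hx, h1, smul_mul_assoc, one_mul, map_smul, map_smul, hy,
      Bialgebra.counit_mul, map_mul, Algebra.smul_def]

lemma antipode_right (x : JGL h g) : LinearMap.mul' ℂ (JGL h g)
    ((antipodeLin h g).lTensor (JGL h g) (Coalgebra.comul x)) =
      algebraMap ℂ (JGL h g) (Coalgebra.counit x) := by
  induction x using induction with
  | hgen x =>
    have H := isQuantumMatrix (h := h) (g := g)
    obtain ⟨ha, hb, hc, hd⟩ := (antipode_gen_aux H).2
    cases x <;> simp only [comul_gen, counit_gen, genValue, map_add, LinearMap.lTensor_tmul,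
      LinearMap.mul'_apply, antipodeLin_gen, map_one, map_zero]
    exacts [ha, hb, hc, hd, H.inv_det]
  | halg r => simp [Algebra.algebraMap_eq_smul_one, Algebra.TensorProduct.one_def, antipodeLin_one]
  | hadd x y hx hy => simp [hx, hy]
  | hmul x y hx hy =>
    have key : ∀ u v : JGL h g ⊗[ℂ] JGL h g,
        LinearMap.mul' ℂ (JGL h g) ((antipodeLin h g).lTensor (JGL h g) (u * v)) =
        LinearMap.mul' ℂ (JGL h g) ((antipodeLin h g).lTensor (JGL h g)
          (u * (LinearMap.mul' ℂ (JGL h g) ((antipodeLin h g).lTensor (JGL h g) v) ⊗ₜ 1))) := by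
      intro u v
      induction u using TensorProduct.induction_on with
      | zero => simp
      | add u u' hu hu' => simp only [add_mul, map_add, hu, hu']
      | tmul p q =>
        induction v using TensorProduct.induction_on with
        | zero => simp
        | add v v' hv hv' => simp only [mul_add, map_add, TensorProduct.add_tmul, hv, hv']
        | tmul p' q' => simp [antipodeLin_mul, mul_assoc]
    have h1 : ∀ r : ℂ, algebraMap ℂ (JGL h g) r ⊗ₜ[ℂ] (1 : JGL h g) =
        r • (1 : JGL h g ⊗[ℂ] JGL h g) := fun r => by
      rw [Algebra.algebraMap_eq_smul_one, ← TensorProduct.smul_tmul',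
        Algebra.TensorProduct.one_def]
    rw [Bialgebra.comul_mul, key, hy, h1, mul_smul_comm, mul_one, map_smul, map_smul, hx,
      Bialgebra.counit_mul]
    simp [Algebra.algebraMap_eq_smul_one, smul_smul, mul_comm]

instance : HopfAlgebra ℂ (JGL h g) where
  antipode := antipodeLin h g
  mul_antipode_rTensor_comul := LinearMap.ext fun x => antipode_left x
  mul_antipode_lTensor_comul := LinearMap.ext fun x => antipode_right x

end JGL
open JGL

variable {h g : ℂ}

/-! ### Four-dimensional first order differential calculi -/

/-- A square matrix `M` bordered by a scalar and a row: `(ε χ; 0 M)`. -/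
def bordered (ε : ℂ) (χ : Fin 4 → ℂ) (M : Matrix (Fin 4) (Fin 4) ℂ) :
    Matrix (Fin 1 ⊕ Fin 4) (Fin 1 ⊕ Fin 4) ℂ :=
  Matrix.fromBlocks (Matrix.of fun _ _ => ε) (Matrix.of fun _ j => χ j) 0 M

lemma bordered_mul (ε ε' : ℂ) (χ χ' : Fin 4 → ℂ) (M M' : Matrix (Fin 4) (Fin 4) ℂ) :
    bordered ε χ M * bordered ε' χ' M' =
      bordered (ε * ε') (ε • χ' + Matrix.vecMul χ M') (M * M') := by
  rw [bordered, bordered, Matrix.fromBlocks_multiply, bordered]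
  congr 1
  · ext; simp [Matrix.mul_apply]
  · ext; simp [Matrix.mul_apply, Matrix.vecMul, dotProduct]
  · simp
  · simp

lemma bordered_add (ε ε' : ℂ) (χ χ' : Fin 4 → ℂ) (M M' : Matrix (Fin 4) (Fin 4) ℂ) :
    bordered ε χ M + bordered ε' χ' M' = bordered (ε + ε') (χ + χ') (M + M') := by
  rw [bordered, bordered, Matrix.fromBlocks_add, bordered, add_zero]; rfl

lemma bordered_smul (r ε : ℂ) (χ : Fin 4 → ℂ) (M : Matrix (Fin 4) (Fin 4) ℂ) :
    r • bordered ε χ M = bordered (r * ε) (r • χ) (r • M) := by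
  rw [bordered, Matrix.fromBlocks_smul, bordered, smul_zero]; rfl

lemma bordered_sub (ε ε' : ℂ) (χ χ' : Fin 4 → ℂ) (M M' : Matrix (Fin 4) (Fin 4) ℂ) :
    bordered ε χ M - bordered ε' χ' M' = bordered (ε - ε') (χ - χ') (M - M') := by
  ext (i | i) (j | j) <;> simp [bordered]

lemma bordered_one : (1 : Matrix (Fin 1 ⊕ Fin 4) (Fin 1 ⊕ Fin 4) ℂ) = bordered 1 0 1 := by
  ext (i | i) (j | j)
  · simp [bordered, Matrix.one_apply, Subsingleton.elim i j]
  all_goals simp [bordered, Matrix.one_apply]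

lemma bordered_congr {ε ε' : ℂ} {χ χ' : Fin 4 → ℂ} {M M' : Matrix (Fin 4) (Fin 4) ℂ}
    (h₁ : ε = ε') (h₂ : χ = χ') (h₃ : M = M') : bordered ε χ M = bordered ε' χ' M' := by
  rw [h₁, h₂, h₃]

lemma bordered_isQuantumMatrix {A B C D E : Matrix (Fin 4) (Fin 4) ℂ} {α β γ δ w : Fin 4 → ℂ}
    (H : IsQuantumMatrix h g A B C D E)
    (ca : Matrix.vecMul γ A = γ + Matrix.vecMul α C - g • Matrix.vecMul γ C)
    (cd : Matrix.vecMul γ D = γ + Matrix.vecMul δ C - h • Matrix.vecMul γ C)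
    (db : β + Matrix.vecMul δ B = Matrix.vecMul β D + g • ((δ + Matrix.vecMul α D) -
      Matrix.vecMul β C + h • (γ + Matrix.vecMul α C) - (δ + Matrix.vecMul δ D)))
    (ab : β + Matrix.vecMul α B = Matrix.vecMul β A + h • ((δ + Matrix.vecMul α D) -
      Matrix.vecMul β C + h • (γ + Matrix.vecMul α C) - (α + Matrix.vecMul α A)))
    (cb : Matrix.vecMul γ B = Matrix.vecMul β C - h • (γ + Matrix.vecMul α C) -
      g • (γ + Matrix.vecMul δ C) + (g * h) • Matrix.vecMul γ C)
    (da : α + Matrix.vecMul δ A = (δ + Matrix.vecMul α D) + h • (γ + Matrix.vecMul α C) -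
      g • (γ + Matrix.vecMul δ C))
    (det : w + Matrix.vecMul ((δ + Matrix.vecMul α D) - Matrix.vecMul β C +
      h • (γ + Matrix.vecMul α C)) E = 0) :
    IsQuantumMatrix h g (bordered 1 α A) (bordered 0 β B) (bordered 0 γ C) (bordered 1 δ D)
      (bordered 1 w E) := by
  have det' : (δ + Matrix.vecMul α D) - Matrix.vecMul β C + h • (γ + Matrix.vecMul α C) +
      Matrix.vecMul w (A * D - B * C + h • (A * C)) = 0 := by
    rw [eq_neg_of_add_eq_zero_left det, Matrix.neg_vecMul, Matrix.vecMul_vecMul, H.inv_det,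
      Matrix.vecMul_one, add_neg_cancel]
  constructor <;>
    simp only [bordered_mul, bordered_add, bordered_sub, bordered_smul, bordered_one] <;>
    refine bordered_congr (by simp) ?_ ?_
  · simpa using ca
  · exact H.ca
  · simpa using cd
  · exact H.cd
  · simpa using db
  · exact H.db
  · simpa using ab
  · exact H.ab
  · simpa using cb
  · exact H.cb
  · simpa using da
  · exact H.da
  · simpa using det
  · exact H.det_inv
  · simpa using det'
  · exact H.inv_det

lemma mul₄ (a00 a01 a02 a03 a10 a11 a12 a13 a20 a21 a22 a23 a30 a31 a32 a33 b00 b01 b02 b03 b10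
    b11 b12 b13 b20 b21 b22 b23 b30 b31 b32 b33 : ℂ) : !![a00, a01, a02, a03; a10, a11, a12, a13;
    a20, a21, a22, a23; a30, a31, a32, a33] * !![b00, b01, b02, b03; b10, b11, b12, b13; b20, b21,
    b22, b23; b30, b31, b32, b33] = !![a00 * b00 + a01 * b10 + a02 * b20 + a03 * b30, a00 * b01 +
    a01 * b11 + a02 * b21 + a03 * b31, a00 * b02 + a01 * b12 + a02 * b22 + a03 * b32, a00 * b03 +
    a01 * b13 + a02 * b23 + a03 * b33; a10 * b00 + a11 * b10 + a12 * b20 + a13 * b30, a10 * b01 +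
    a11 * b11 + a12 * b21 + a13 * b31, a10 * b02 + a11 * b12 + a12 * b22 + a13 * b32, a10 * b03 +
    a11 * b13 + a12 * b23 + a13 * b33; a20 * b00 + a21 * b10 + a22 * b20 + a23 * b30, a20 * b01 +
    a21 * b11 + a22 * b21 + a23 * b31, a20 * b02 + a21 * b12 + a22 * b22 + a23 * b32, a20 * b03 +
    a21 * b13 + a22 * b23 + a23 * b33; a30 * b00 + a31 * b10 + a32 * b20 + a33 * b30, a30 * b01 +
    a31 * b11 + a32 * b21 + a33 * b31, a30 * b02 + a31 * b12 + a32 * b22 + a33 * b32, a30 * b03 +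
    a31 * b13 + a32 * b23 + a33 * b33] := by
  ext i j; fin_cases i <;> fin_cases j <;> simp [Matrix.mul_apply, Fin.sum_univ_four]

lemma add₄ (a00 a01 a02 a03 a10 a11 a12 a13 a20 a21 a22 a23 a30 a31 a32 a33 b00 b01 b02 b03 b10
    b11 b12 b13 b20 b21 b22 b23 b30 b31 b32 b33 : ℂ) : !![a00, a01, a02, a03; a10, a11, a12, a13;
    a20, a21, a22, a23; a30, a31, a32, a33] + !![b00, b01, b02, b03; b10, b11, b12, b13; b20, b21,
    b22, b23; b30, b31, b32, b33] = !![a00 + b00, a01 + b01, a02 + b02, a03 + b03; a10 + b10, a11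
    + b11, a12 + b12, a13 + b13; a20 + b20, a21 + b21, a22 + b22, a23 + b23; a30 + b30, a31 + b31,
    a32 + b32, a33 + b33] := by
  ext i j; fin_cases i <;> fin_cases j <;> simp

lemma sub₄ (a00 a01 a02 a03 a10 a11 a12 a13 a20 a21 a22 a23 a30 a31 a32 a33 b00 b01 b02 b03 b10
    b11 b12 b13 b20 b21 b22 b23 b30 b31 b32 b33 : ℂ) : !![a00, a01, a02, a03; a10, a11, a12, a13;
    a20, a21, a22, a23; a30, a31, a32, a33] - !![b00, b01, b02, b03; b10, b11, b12, b13; b20, b21,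
    b22, b23; b30, b31, b32, b33] = !![a00 - b00, a01 - b01, a02 - b02, a03 - b03; a10 - b10, a11
    - b11, a12 - b12, a13 - b13; a20 - b20, a21 - b21, a22 - b22, a23 - b23; a30 - b30, a31 - b31,
    a32 - b32, a33 - b33] := by
  ext i j; fin_cases i <;> fin_cases j <;> simp

lemma smul₄ (r a00 a01 a02 a03 a10 a11 a12 a13 a20 a21 a22 a23 a30 a31 a32 a33 : ℂ) : r • !![a00,
    a01, a02, a03; a10, a11, a12, a13; a20, a21, a22, a23; a30, a31, a32, a33] = !![r * a00, r *
    a01, r * a02, r * a03; r * a10, r * a11, r * a12, r * a13; r * a20, r * a21, r * a22, r * a23;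
    r * a30, r * a31, r * a32, r * a33] := by
  ext i j; fin_cases i <;> fin_cases j <;> simp

lemma one₄ : (1 : Matrix (Fin 4) (Fin 4) ℂ) = !![1, 0, 0, 0; 0, 1, 0, 0; 0, 0, 1, 0; 0, 0, 0, 1] := by
  ext i j; fin_cases i <;> fin_cases j <;> simp

lemma congr₄ {a00 a01 a02 a03 a10 a11 a12 a13 a20 a21 a22 a23 a30 a31 a32 a33 b00 b01 b02 b03 b10
    b11 b12 b13 b20 b21 b22 b23 b30 b31 b32 b33 : ℂ} (h00 : a00 = b00) (h01 : a01 = b01) (h02 :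
    a02 = b02) (h03 : a03 = b03) (h10 : a10 = b10) (h11 : a11 = b11) (h12 : a12 = b12) (h13 : a13
    = b13) (h20 : a20 = b20) (h21 : a21 = b21) (h22 : a22 = b22) (h23 : a23 = b23) (h30 : a30 =
    b30) (h31 : a31 = b31) (h32 : a32 = b32) (h33 : a33 = b33) : !![a00, a01, a02, a03; a10, a11,
    a12, a13; a20, a21, a22, a23; a30, a31, a32, a33] = !![b00, b01, b02, b03; b10, b11, b12, b13;
    b20, b21, b22, b23; b30, b31, b32, b33] := by
  rw [h00, h01, h02, h03, h10, h11, h12, h13, h20, h21, h22, h23, h30, h31, h32, h33]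

lemma vecMul₄ (x0 x1 x2 x3 a00 a01 a02 a03 a10 a11 a12 a13 a20 a21 a22 a23 a30 a31 a32 a33 : ℂ) :
    Matrix.vecMul ![x0, x1, x2, x3]
      !![a00, a01, a02, a03; a10, a11, a12, a13; a20, a21, a22, a23; a30, a31, a32, a33] =
    ![x0 * a00 + x1 * a10 + x2 * a20 + x3 * a30, x0 * a01 + x1 * a11 + x2 * a21 + x3 * a31,
      x0 * a02 + x1 * a12 + x2 * a22 + x3 * a32, x0 * a03 + x1 * a13 + x2 * a23 + x3 * a33] := by
  ext j; fin_cases j <;> simp [Matrix.vecMul, dotProduct, Fin.sum_univ_four]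

lemma rowAdd₄ (x0 x1 x2 x3 y0 y1 y2 y3 : ℂ) :
    (![x0, x1, x2, x3] + ![y0, y1, y2, y3] : Fin 4 → ℂ) =
      ![x0 + y0, x1 + y1, x2 + y2, x3 + y3] := by
  ext j; fin_cases j <;> simp

lemma rowSub₄ (x0 x1 x2 x3 y0 y1 y2 y3 : ℂ) :
    (![x0, x1, x2, x3] - ![y0, y1, y2, y3] : Fin 4 → ℂ) =
      ![x0 - y0, x1 - y1, x2 - y2, x3 - y3] := by
  ext j; fin_cases j <;> simp

lemma rowSmul₄ (r x0 x1 x2 x3 : ℂ) :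
    (r • ![x0, x1, x2, x3] : Fin 4 → ℂ) = ![r * x0, r * x1, r * x2, r * x3] := by
  ext j; fin_cases j <;> simp

lemma rowCongr₄ {x0 x1 x2 x3 y0 y1 y2 y3 : ℂ} (h0 : x0 = y0) (h1 : x1 = y1) (h2 : x2 = y2)
    (h3 : x3 = y3) : (![x0, x1, x2, x3] : Fin 4 → ℂ) = ![y0, y1, y2, y3] := by
  rw [h0, h1, h2, h3]

lemma rowZero₄ : (0 : Fin 4 → ℂ) = ![0, 0, 0, 0] := by
  ext j; fin_cases j <;> simp

lemma scaled_inverse {r : ℂ} (hr : r ≠ 0) {M N : Matrix (Fin 4) (Fin 4) ℂ}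
    (h₁ : M * N = r • 1) (h₂ : N * M = r • 1) : M * (r⁻¹ • N) = 1 ∧ r⁻¹ • N * M = 1 := by
  constructor
  · rw [mul_smul_comm, h₁, smul_smul, inv_mul_cancel₀ hr, one_smul]
  · rw [smul_mul_assoc, h₂, smul_smul, inv_mul_cancel₀ hr, one_smul]

/-- The `ABCD` matrices of a 4-dimensional first order differential calculus on `GL_{h,g}(2)` which
is free as a left module on the left-invariant forms
`θ₁ = P(da), θ₂ = P(db), θ₃ = P(dc), θ₄ = P(dd)` (indexed by `0, 1, 2, 3 : Fin 4`).
The matrices describe the right module structure,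
`θᵢ a = ∑ⱼ (a Aᵢⱼ + b Cᵢⱼ) θⱼ`, `θᵢ b = ∑ⱼ (a Bᵢⱼ + b Dᵢⱼ) θⱼ`, and similarly for `c, d`.
`rep` says that they represent `GL_{h,g}(2)`, with `E` the image of the inverse determinant. `leibniz`
says that the differential with `dT = T Θ`, where `Θ = (θ₁ θ₂; θ₃ θ₄)`, is compatible with the
relations: its components `χⱼ` along `θⱼ` at the counit satisfy
`χⱼ(x y) = ∑ᵢ χᵢ(x) fᵢⱼ(y) + ε(x) χⱼ(y)`, so that `ε`, `χ` and `f` make up a bordered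
representation. `w` is the value of `χ` on the inverse determinant. -/
structure CalculusMatrices (h g : ℂ) where
  (A B C D E : Matrix (Fin 4) (Fin 4) ℂ)
  w : Fin 4 → ℂ
  rep : IsQuantumMatrix h g A B C D E
  leibniz : IsQuantumMatrix h g (bordered 1 ![1, 0, 0, 0] A) (bordered 0 ![0, 1, 0, 0] B)
    (bordered 0 ![0, 0, 1, 0] C) (bordered 1 ![0, 0, 0, 1] D) (bordered 1 w E)

lemma rep₁ (h g z : ℂ) (hz : z ≠ -1) : IsQuantumMatrix h g
    !![(3 * z + 2) / 2, 0, (-(3 * h + g) * z - 2 * h) / 2, -z / 2;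
    h * (z + 1), z + 1, -h ^ 2 * (z + 1), -h * (z + 1);
    0, 0, z + 1, 0;
    z / 2, 0, ((h - g) * z + 2 * h) / 2, (z + 2) / 2]
    !![0, z, h * (h + g) * (z + 1), 0;
    0, (h + g) * (z + 1), -h * g * (h + g) * (z + 1), 0;
    0, 0, -(h + g) * (z + 1), 0;
    0, z, g * (h + g) * (z + 1), 0]
    !![0, 0, z, 0;
    0, 0, 0, 0;
    0, 0, 0, 0;
    0, 0, z, 0]
    !![(z + 2) / 2, 0, (-(h - g) * z + 2 * g) / 2, z / 2;
    -g * (z + 1), z + 1, -g ^ 2 * (z + 1), g * (z + 1);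
    0, 0, z + 1, 0;
    -z / 2, 0, (-(h + 3 * g) * z - 2 * g) / 2, (3 * z + 2) / 2]
    (((z + 1) ^ 2)⁻¹ •
    !![1, 0, h - g, 0;
        -(h - g), 1, -(h - g) ^ 2, h - g;
        0, 0, 1, 0;
        0, 0, -(h - g), 1]) := by
  have hr : (z + 1) ^ 2 ≠ 0 := pow_ne_zero 2 fun H => hz (by linear_combination H)
  constructor
  case det_inv =>
    refine (scaled_inverse hr ?_ ?_).1 <;>
    · simp only [mul₄, add₄, sub₄, smul₄, one₄]
      apply congr₄ <;> ring
  case inv_det =>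
    refine (scaled_inverse hr ?_ ?_).2 <;>
    · simp only [mul₄, add₄, sub₄, smul₄, one₄]
      apply congr₄ <;> ring
  all_goals
    simp only [mul₄, add₄, sub₄, smul₄, one₄]
    apply congr₄ <;> ring

/-- The first family of 4-dimensional calculi; `z ≠ -1` makes the determinant invertible. -/
def family₁ (h g z : ℂ) (hz : z ≠ -1) : CalculusMatrices h g where
  A := !![(3 * z + 2) / 2, 0, (-(3 * h + g) * z - 2 * h) / 2, -z / 2;
        h * (z + 1), z + 1, -h ^ 2 * (z + 1), -h * (z + 1);
        0, 0, z + 1, 0;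
        z / 2, 0, ((h - g) * z + 2 * h) / 2, (z + 2) / 2]
  B := !![0, z, h * (h + g) * (z + 1), 0;
        0, (h + g) * (z + 1), -h * g * (h + g) * (z + 1), 0;
        0, 0, -(h + g) * (z + 1), 0;
        0, z, g * (h + g) * (z + 1), 0]
  C := !![0, 0, z, 0;
        0, 0, 0, 0;
        0, 0, 0, 0;
        0, 0, z, 0]
  D := !![(z + 2) / 2, 0, (-(h - g) * z + 2 * g) / 2, z / 2;
        -g * (z + 1), z + 1, -g ^ 2 * (z + 1), g * (z + 1);
        0, 0, z + 1, 0;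
        -z / 2, 0, (-(h + 3 * g) * z - 2 * g) / 2, (3 * z + 2) / 2]
  E := ((z + 1) ^ 2)⁻¹ •
    !![1, 0, h - g, 0;
        -(h - g), 1, -(h - g) ^ 2, h - g;
        0, 0, 1, 0;
        0, 0, -(h - g), 1]
  w := ((z + 1) ^ 2)⁻¹ • ![-(z + 2) / 2, 0, -(z + 2) / 2 * (h + g), -(z + 2) / 2]
  rep := rep₁ h g z hz
  leibniz := by
    apply bordered_isQuantumMatrix (rep₁ h g z hz)
    case det =>
      rw [Matrix.vecMul_smul, ← smul_add]
      refine (congrArg _ ?_).trans (smul_zero _)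
      simp only [vecMul₄, rowAdd₄, rowSub₄, rowSmul₄, rowZero₄]
      apply rowCongr₄ <;> ring
    all_goals
      simp only [vecMul₄, rowAdd₄, rowSub₄, rowSmul₄, rowZero₄]
      apply rowCongr₄ <;> ring

lemma rep₂ (h g z : ℂ) : IsQuantumMatrix h g
    !![(z + 2) / 2, 0, ((h + g) * z - 2 * h) / 2, z / 2;
    h * (z + 1), 1, h * ((h + g) * z - h), h * (z - 1);
    0, 0, 1, 0;
    -z / 2, 0, (-(h + g) * z + 2 * h) / 2, (-z + 2) / 2]
    !![-h * z, 0, h * (h + g) * (1 - z), -h * z;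
    h * g * z, h + g, h * g * (h + g) * (z - 1), g * h * z;
    z, 0, (h + g) * (z - 1), z;
    -g * z, 0, g * (h + g) * (1 - z), -g * z]
    !![0, 0, 0, 0;
    z, 0, (h + g) * z, z;
    0, 0, 0, 0;
    0, 0, 0, 0]
    !![(-z + 2) / 2, 0, (-(h + g) * z + 2 * g) / 2, -z / 2;
    g * (z - 1), 1, g * ((h + g) * z - g), g * (z + 1);
    0, 0, 1, 0;
    z / 2, 0, ((h + g) * z - 2 * g) / 2, (z + 2) / 2]
    (!![1, 0, h - g, 0;
        -(h - g), 1, -(h - g) ^ 2, h - g;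
        0, 0, 1, 0;
        0, 0, -(h - g), 1]) := by
  constructor
  all_goals
    simp only [mul₄, add₄, sub₄, smul₄, one₄]
    apply congr₄ <;> ring

/-- The second family of 4-dimensional calculi. -/
def family₂ (h g z : ℂ) : CalculusMatrices h g where
  A := !![(z + 2) / 2, 0, ((h + g) * z - 2 * h) / 2, z / 2;
        h * (z + 1), 1, h * ((h + g) * z - h), h * (z - 1);
        0, 0, 1, 0;
        -z / 2, 0, (-(h + g) * z + 2 * h) / 2, (-z + 2) / 2]
  B := !![-h * z, 0, h * (h + g) * (1 - z), -h * z;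
        h * g * z, h + g, h * g * (h + g) * (z - 1), g * h * z;
        z, 0, (h + g) * (z - 1), z;
        -g * z, 0, g * (h + g) * (1 - z), -g * z]
  C := !![0, 0, 0, 0;
        z, 0, (h + g) * z, z;
        0, 0, 0, 0;
        0, 0, 0, 0]
  D := !![(-z + 2) / 2, 0, (-(h + g) * z + 2 * g) / 2, -z / 2;
        g * (z - 1), 1, g * ((h + g) * z - g), g * (z + 1);
        0, 0, 1, 0;
        z / 2, 0, ((h + g) * z - 2 * g) / 2, (z + 2) / 2]
  E := !![1, 0, h - g, 0;
        -(h - g), 1, -(h - g) ^ 2, h - g;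
        0, 0, 1, 0;
        0, 0, -(h - g), 1]
  w := ![(3 * z - 2) / 2, 0, (3 * z - 2) / 2 * (h + g), (3 * z - 2) / 2]
  rep := rep₂ h g z
  leibniz := by
    apply bordered_isQuantumMatrix (rep₂ h g z)
    all_goals
      simp only [vecMul₄, rowAdd₄, rowSub₄, rowSmul₄, rowZero₄]
      apply rowCongr₄ <;> ring

lemma rep₃ (h g z : ℂ) (hz : z ≠ -1) : IsQuantumMatrix h g
    !![(z + 2) / 2, 0, ((h + g) * z - 2 * h) / 2, z / 2;
    h, 1, -h ^ 2, -h;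
    0, 0, 1, 0;
    z / 2, 0, ((h + g) * z + 2 * h) / 2, (z + 2) / 2]
    !![0, 0, h * (h + g), 0;
    0, h + g, -h * g * (h + g), 0;
    0, 0, -(h + g), 0;
    0, 0, g * (h + g), 0]
    !![0, 0, 0, 0;
    0, 0, 0, 0;
    0, 0, 0, 0;
    0, 0, 0, 0]
    !![(z + 2) / 2, 0, ((h + g) * z + 2 * g) / 2, z / 2;
    -g, 1, -g ^ 2, g;
    0, 0, 1, 0;
    z / 2, 0, ((h + g) * z - 2 * g) / 2, (z + 2) / 2]
    (((z + 1) ^ 2)⁻¹ •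
    !![(z ^ 2 + 2 * z + 2) / 2, 0, (h - g) * (z + 1) ^ 2 - (h + g) * z * (z + 2) / 2,
          -z * (z + 2) / 2;
        -(h - g) * (z + 1) ^ 2, (z + 1) ^ 2, -(h - g) ^ 2 * (z + 1) ^ 2, (h - g) * (z + 1) ^ 2;
        0, 0, (z + 1) ^ 2, 0;
        -z * (z + 2) / 2, 0, -(h - g) * (z + 1) ^ 2 - (h + g) * z * (z + 2) / 2,
          (z ^ 2 + 2 * z + 2) / 2]) := by
  have hr : (z + 1) ^ 2 ≠ 0 := pow_ne_zero 2 fun H => hz (by linear_combination H)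
  constructor
  case det_inv =>
    refine (scaled_inverse hr ?_ ?_).1 <;>
    · simp only [mul₄, add₄, sub₄, smul₄, one₄]
      apply congr₄ <;> ring
  case inv_det =>
    refine (scaled_inverse hr ?_ ?_).2 <;>
    · simp only [mul₄, add₄, sub₄, smul₄, one₄]
      apply congr₄ <;> ring
  all_goals
    simp only [mul₄, add₄, sub₄, smul₄, one₄]
    apply congr₄ <;> ring

/-- The third family of 4-dimensional calculi; `z ≠ -1` makes the determinant invertible. -/
def family₃ (h g z : ℂ) (hz : z ≠ -1) : CalculusMatrices h g where
  A := !![(z + 2) / 2, 0, ((h + g) * z - 2 * h) / 2, z / 2;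
        h, 1, -h ^ 2, -h;
        0, 0, 1, 0;
        z / 2, 0, ((h + g) * z + 2 * h) / 2, (z + 2) / 2]
  B := !![0, 0, h * (h + g), 0;
        0, h + g, -h * g * (h + g), 0;
        0, 0, -(h + g), 0;
        0, 0, g * (h + g), 0]
  C := !![0, 0, 0, 0;
        0, 0, 0, 0;
        0, 0, 0, 0;
        0, 0, 0, 0]
  D := !![(z + 2) / 2, 0, ((h + g) * z + 2 * g) / 2, z / 2;
        -g, 1, -g ^ 2, g;
        0, 0, 1, 0;
        z / 2, 0, ((h + g) * z - 2 * g) / 2, (z + 2) / 2]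
  E := ((z + 1) ^ 2)⁻¹ •
    !![(z ^ 2 + 2 * z + 2) / 2, 0, (h - g) * (z + 1) ^ 2 - (h + g) * z * (z + 2) / 2,
          -z * (z + 2) / 2;
        -(h - g) * (z + 1) ^ 2, (z + 1) ^ 2, -(h - g) ^ 2 * (z + 1) ^ 2, (h - g) * (z + 1) ^ 2;
        0, 0, (z + 1) ^ 2, 0;
        -z * (z + 2) / 2, 0, -(h - g) * (z + 1) ^ 2 - (h + g) * z * (z + 2) / 2,
          (z ^ 2 + 2 * z + 2) / 2]
  w := ((z + 1) ^ 2)⁻¹ • ![-(z + 2) / 2, 0, -(z + 2) / 2 * (h + g), -(z + 2) / 2]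
  rep := rep₃ h g z hz
  leibniz := by
    apply bordered_isQuantumMatrix (rep₃ h g z hz)
    case det =>
      rw [Matrix.vecMul_smul, ← smul_add]
      refine (congrArg _ ?_).trans (smul_zero _)
      simp only [vecMul₄, rowAdd₄, rowSub₄, rowSmul₄, rowZero₄]
      apply rowCongr₄ <;> ring
    all_goals
      simp only [vecMul₄, rowAdd₄, rowSub₄, rowSmul₄, rowZero₄]
      apply rowCongr₄ <;> ring

/-- `φ ⋆ a = a₍₁₎ φ(a₍₂₎)`, the left action of a functional on a Hopf algebra. -/
def convAct {H : Type*} [Ring H] [HopfAlgebra ℂ H] (φ : Module.Dual ℂ H) : H →ₗ[ℂ] H :=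
  (TensorProduct.rid ℂ H).toLinearMap ∘ₗ φ.lTensor H ∘ₗ Coalgebra.comul

/-- The right adjoint coaction `a ↦ a₍₂₎ ⊗ S(a₍₁₎) a₍₃₎` of a Hopf algebra on itself. -/
def adCoaction (H : Type*) [Ring H] [HopfAlgebra ℂ H] : H →ₗ[ℂ] H ⊗[ℂ] H :=
  (LinearMap.mul' ℂ H ∘ₗ (HopfAlgebra.antipode ℂ).rTensor H).lTensor H ∘ₗ
    (TensorProduct.leftComm ℂ H H H).toLinearMap ∘ₗ
      (Coalgebra.comul (R := ℂ) (A := H)).lTensor H ∘ₗ Coalgebra.comul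

/-- The right adjoint action of functionals, `φ ◁ ψ = S(ψ₍₁₎) φ ψ₍₂₎`, that is
`(φ ◁ ψ)(a) = φ(a₍₂₎) ψ(S(a₍₁₎) a₍₃₎)`. On the quantum Lie algebra of a bicovariant calculus it is
the quantum Lie bracket `[φ, ψ]`. -/
def quantumBracket {H : Type*} [Ring H] [HopfAlgebra ℂ H] (φ ψ : Module.Dual ℂ H) :
    Module.Dual ℂ H :=
  LinearMap.mul' ℂ ℂ ∘ₗ TensorProduct.map φ ψ ∘ₗ adCoaction H

/-- The space of 1-forms: the free left module on the left-invariant forms `θ₁, θ₂, θ₃, θ₄`. -/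
abbrev Form (h g : ℂ) : Type := Fin 4 → JGL h g

/-- The left coaction on 1-forms, `Δ_L(∑ aᵢ θᵢ) = ∑ Δ(aᵢ) (1 ⊗ θᵢ)`. -/
def leftCoaction (h g : ℂ) : Form h g →ₗ[ℂ] JGL h g ⊗[ℂ] Form h g :=
  ∑ i, (LinearMap.single ℂ (fun _ : Fin 4 => JGL h g) i).lTensor (JGL h g) ∘ₗ
    Coalgebra.comul ∘ₗ LinearMap.proj i

/-- The projection `P(ω) = S(ω₍A₎) ω₍Γ₎` onto the left-invariant forms. -/
def invProj (h g : ℂ) : Form h g →ₗ[ℂ] Form h g :=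
  TensorProduct.lift ((Algebra.lsmul ℂ ℂ (Form h g)).toLinearMap ∘ₗ HopfAlgebra.antipode ℂ) ∘ₗ
    leftCoaction h g

/-- The matrix `V = (vᵢⱼ)` of the right coaction `Δ_R(θᵢ) = ∑ⱼ θⱼ ⊗ vⱼᵢ` on the left-invariant
forms, which is determined by `Δ_R(dx) = (d ⊗ id) Δ(x)`. -/
def coactionMatrix (h g : ℂ) : Matrix (Fin 4) (Fin 4) (JGL h g) :=
  let a := gen h g .a
  let b := gen h g .b
  let c := gen h g .c
  let d := gen h g .d
  let S : JGL h g →ₗ[ℂ] JGL h g := HopfAlgebra.antipode ℂ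
  !![S a * a, S a * b, S c * a, S c * b;
     S a * c, S a * d, S c * c, S c * d;
     S b * a, S b * b, S d * a, S d * b;
     S b * c, S b * d, S d * c, S d * d]

/-- Elements `aⱼ` of the augmentation ideal with `P(daⱼ) = θⱼ`: `a - 1, b, c, d - 1`. -/
def coord (h g : ℂ) : Fin 4 → JGL h g :=
  ![gen h g .a - 1, gen h g .b, gen h g .c, gen h g .d - 1]

namespace CalculusMatrices

variable (X : CalculusMatrices h g)

/-- The representation `(fᵢⱼ)` of `GL_{h,g}(2)` given by the `ABCD` matrices. -/
def f : JGL h g →ₐ[ℂ] Matrix (Fin 4) (Fin 4) ℂ := lift X.rep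

/-- The functional `fᵢⱼ`. -/
def fEntry (i j : Fin 4) : Module.Dual ℂ (JGL h g) :=
  Matrix.entryLinearMap ℂ ℂ i j ∘ₗ X.f.toLinearMap

/-- The bordered representation `(ε χ; 0 f)`. -/
def borderedRep : JGL h g →ₐ[ℂ] Matrix (Fin 1 ⊕ Fin 4) (Fin 1 ⊕ Fin 4) ℂ := lift X.leibniz

/-- The functional `χⱼ`, dual to `θⱼ`. -/
def chi (j : Fin 4) : Module.Dual ℂ (JGL h g) :=
  Matrix.entryLinearMap ℂ ℂ (Sum.inl 0) (Sum.inr j) ∘ₗ X.borderedRep.toLinearMap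

/-- The right module structure on 1-forms: `(∑ᵢ aᵢ θᵢ) b = ∑ᵢⱼ aᵢ (fᵢⱼ ⋆ b) θⱼ`. -/
def rightMul (ω : Form h g) (b : JGL h g) : Form h g :=
  fun j => ∑ i, ω i * convAct (X.fEntry i j) b

/-- The differential, `dx = ∑ⱼ (χⱼ ⋆ x) θⱼ`. -/
def differential : JGL h g →ₗ[ℂ] Form h g := LinearMap.pi fun j => convAct (X.chi j)

lemma borderedRep_eq (x : JGL h g) : X.borderedRep x =
    bordered (Coalgebra.counit x) (fun j => X.chi j x) (X.f x) := by
  have key : ∀ x, (X.borderedRep x).toBlocks₂₁ = 0 ∧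
      (X.borderedRep x).toBlocks₂₂ = X.f x ∧
      (X.borderedRep x) (Sum.inl 0) (Sum.inl 0) = Coalgebra.counit x := by
    intro x
    induction x using induction with
    | hgen x =>
      simp only [borderedRep, f, lift_gen, counit_gen]
      cases x <;> simp [genValue, bordered]
    | halg r =>
      simp only [AlgHomClass.commutes, Bialgebra.counit_algebraMap]
      refine ⟨?_, ?_, ?_⟩
      · ext i j; simp [Matrix.toBlocks₂₁, Matrix.algebraMap_matrix_apply]
      · ext i j; simp [Matrix.toBlocks₂₂, Matrix.algebraMap_matrix_apply]
      · simp [Matrix.algebraMap_matrix_apply]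
    | hadd x y hx hy =>
      simp only [map_add, ← hx.2.1, ← hy.2.1, ← hx.2.2, ← hy.2.2]
      refine ⟨?_, rfl, rfl⟩
      exact (congrArg₂ (· + ·) hx.1 hy.1).trans (add_zero _)
    | hmul x y hx hy =>
      have e := Matrix.fromBlocks_multiply (X.borderedRep x).toBlocks₁₁ (X.borderedRep x).toBlocks₁₂
        (X.borderedRep x).toBlocks₂₁ (X.borderedRep x).toBlocks₂₂ (X.borderedRep y).toBlocks₁₁
        (X.borderedRep y).toBlocks₁₂ (X.borderedRep y).toBlocks₂₁ (X.borderedRep y).toBlocks₂₂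
      rw [Matrix.fromBlocks_toBlocks, Matrix.fromBlocks_toBlocks, ← map_mul] at e
      rw [e, Matrix.toBlocks_fromBlocks₂₁, Matrix.toBlocks_fromBlocks₂₂, hx.1, hy.1, hx.2.1,
        hy.2.1, map_mul, Bialgebra.counit_mul, ← hx.2.2, ← hy.2.2]
      simp [Matrix.mul_apply, Matrix.toBlocks₁₁]
  obtain ⟨h1, h2, h3⟩ := key x
  rw [← Matrix.fromBlocks_toBlocks (X.borderedRep x), bordered, h1, h2, ← h3]
  congr 1
  · ext i j
    simp [Matrix.toBlocks₁₁, Subsingleton.elim i 0, Subsingleton.elim j 0]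
  · ext i j
    simp [Matrix.toBlocks₁₂, chi, Subsingleton.elim i 0]

lemma chi_mul (j : Fin 4) (x y : JGL h g) :
    X.chi j (x * y) = ∑ i, X.chi i x * X.fEntry i j y + Coalgebra.counit x * X.chi j y := by
  have := congrFun₂ (X.borderedRep_eq (x * y)) (Sum.inl 0) (Sum.inr j)
  rw [map_mul, X.borderedRep_eq x, X.borderedRep_eq y, bordered_mul] at this
  simp only [bordered, Matrix.fromBlocks_apply₁₂, Matrix.of_apply] at this
  rw [← this]
  simp [Matrix.vecMul, dotProduct, fEntry, add_comm]

lemma chi_one (j : Fin 4) : X.chi j 1 = 0 := by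
  simp [chi]

lemma chi_gen (j : Fin 4) (x : Gen) : X.chi j (gen h g x) = genValue
    (![1, 0, 0, 0] j) (![0, 1, 0, 0] j) (![0, 0, 1, 0] j) (![0, 0, 0, 1] j) (X.w j) x := by
  simp only [chi, borderedRep, LinearMap.comp_apply, AlgHom.toLinearMap_apply, lift_gen]
  cases x <;> simp [genValue, bordered]

lemma comul_convAct {H : Type*} [Ring H] [HopfAlgebra ℂ H] (φ : Module.Dual ℂ H) (x : H) :
    LinearMap.mul' ℂ H ((HopfAlgebra.antipode ℂ).rTensor H (Coalgebra.comul (convAct φ x))) =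
      algebraMap ℂ H (φ x) := by
  rw [HopfAlgebra.mul_antipode_rTensor_comul_apply]
  congr 1
  have e : ∀ t : H ⊗[ℂ] H, Coalgebra.counit (R := ℂ) (TensorProduct.rid ℂ H (φ.lTensor H t)) =
      φ (TensorProduct.lid ℂ H ((Coalgebra.counit (R := ℂ)).rTensor H t)) := by
    intro t
    induction t using TensorProduct.induction_on with
    | zero => simp
    | add t t' ht ht' => simp [ht, ht']
    | tmul p q => simp [mul_comm]
  simpa [convAct] using e (Coalgebra.comul x)

lemma invProj_apply (ω : Form h g) (j : Fin 4) : invProj h g ω j =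
    LinearMap.mul' ℂ (JGL h g)
      ((HopfAlgebra.antipode ℂ).rTensor (JGL h g) (Coalgebra.comul (ω j))) := by
  have e : ∀ (i : Fin 4) (t : JGL h g ⊗[ℂ] JGL h g),
      TensorProduct.lift ((Algebra.lsmul ℂ ℂ (Form h g)).toLinearMap ∘ₗ
        HopfAlgebra.antipode ℂ)
        ((LinearMap.single ℂ (fun _ : Fin 4 => JGL h g) i).lTensor (JGL h g) t) =
      Pi.single i (LinearMap.mul' ℂ (JGL h g)
        ((HopfAlgebra.antipode ℂ).rTensor (JGL h g) t)) := by
    intro i t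
    induction t using TensorProduct.induction_on with
    | zero => simp
    | add t t' ht ht' => simp only [map_add, ht, ht', Pi.single_add]
    | tmul p q => ext k; by_cases hk : k = i <;> simp [hk, Pi.single_apply]
  simp only [invProj, leftCoaction, LinearMap.comp_apply, LinearMap.sum_apply, map_sum, e,
    LinearMap.proj_apply, Finset.sum_apply]
  simp [Pi.single_apply]

/-- `P(dx) = ∑ⱼ χⱼ(x) θⱼ`. -/
lemma invProj_differential (x : JGL h g) :
    invProj h g (X.differential x) = fun j => algebraMap ℂ (JGL h g) (X.chi j x) := by
  ext j
  rw [invProj_apply]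
  exact comul_convAct (X.chi j) x

/-- `dT = T Θ`. -/
lemma differential_gen :
    X.differential (gen h g .a) = ![gen h g .a, 0, gen h g .b, 0] ∧
    X.differential (gen h g .b) = ![0, gen h g .a, 0, gen h g .b] ∧
    X.differential (gen h g .c) = ![gen h g .c, 0, gen h g .d, 0] ∧
    X.differential (gen h g .d) = ![0, gen h g .c, 0, gen h g .d] := by
  refine ⟨?_, ?_, ?_, ?_⟩ <;>
  · ext j
    simp only [differential, LinearMap.pi_apply, convAct, LinearMap.comp_apply, comul_gen, genValue]
    fin_cases j <;> simp [chi_gen, genValue]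

/-- The Leibniz rule. -/
lemma differential_mul (x y : JGL h g) :
    X.differential (x * y) = X.rightMul (X.differential x) y + x • X.differential y := by
  ext j
  have e : ∀ s t : JGL h g ⊗[ℂ] JGL h g,
      TensorProduct.rid ℂ (JGL h g) ((X.chi j).lTensor (JGL h g) (s * t)) =
        ∑ i, TensorProduct.rid ℂ (JGL h g) ((X.chi i).lTensor (JGL h g) s) *
          TensorProduct.rid ℂ (JGL h g) ((X.fEntry i j).lTensor (JGL h g) t) +
        TensorProduct.rid ℂ (JGL h g) ((Coalgebra.counit (R := ℂ)).lTensor (JGL h g) s) *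
          TensorProduct.rid ℂ (JGL h g) ((X.chi j).lTensor (JGL h g) t) := by
    intro s t
    induction s using TensorProduct.induction_on with
    | zero => simp
    | add s s' hs hs' =>
      simp only [add_mul, map_add, hs, hs', Finset.sum_add_distrib]
      abel
    | tmul p q =>
      induction t using TensorProduct.induction_on with
      | zero => simp
      | add t t' ht ht' =>
        simp only [mul_add, map_add, ht, ht', Finset.sum_add_distrib]
        abel
      | tmul p' q' =>
        simp only [Algebra.TensorProduct.tmul_mul_tmul, LinearMap.lTensor_tmul,
          TensorProduct.rid_tmul, chi_mul, add_smul, Finset.sum_smul, smul_mul_smul_comm]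
  have := e (Coalgebra.comul x) (Coalgebra.comul y)
  rw [← Bialgebra.comul_mul, Coalgebra.lTensor_counit_comul, TensorProduct.rid_tmul, one_smul]
    at this
  simpa [differential, rightMul, convAct] using this

/-- The subspace `R = {x ∈ ker ε : P(dx) = 0}` which characterises the calculus. -/
def annihilated : Submodule ℂ (JGL h g) :=
  LinearMap.ker (Coalgebra.counit (R := ℂ) (A := JGL h g)) ⊓
    LinearMap.ker (invProj h g ∘ₗ X.differential)

/-- The quantum Lie algebra `L = (ker ε / R)^*`, realised as the space of functionals on
`GL_{h,g}(2)` which vanish at `1` and on `R`. -/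
def quantumLie : Submodule ℂ (Module.Dual ℂ (JGL h g)) :=
  (ℂ ∙ (1 : JGL h g) ⊔ X.annihilated).dualAnnihilator

lemma chi_mem (j : Fin 4) : X.chi j ∈ X.quantumLie := by
  rw [quantumLie, Submodule.dualAnnihilator_sup_eq, Submodule.mem_inf,
    Submodule.mem_dualAnnihilator, Submodule.mem_dualAnnihilator]
  constructor
  · intro x hx
    obtain ⟨r, rfl⟩ := Submodule.mem_span_singleton.mp hx
    rw [map_smul, chi_one, smul_zero]
  · intro x hx
    have h0 : invProj h g (X.differential x) = 0 := hx.2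
    have h1 : algebraMap ℂ (JGL h g) (X.chi j x) = 0 := by
      rw [invProj_differential] at h0
      exact congrFun h0 j
    have h2 := congrArg (Coalgebra.counit (R := ℂ)) h1
    simpa using h2

/-- The basis element `χⱼ` of the quantum Lie algebra. -/
def lieBasis (j : Fin 4) : X.quantumLie := ⟨X.chi j, X.chi_mem j⟩

/-- The braiding coefficients `Λ_{ik,st} = f_{it}(v_{sk})`. -/
def braid (i k s t : Fin 4) : ℂ := X.fEntry i t (coactionMatrix h g s k)

/-- The structure constants `C_{ik,j}` of the quantum Lie bracket, `[χᵢ, χₖ] = ∑ⱼ C_{ik,j} χⱼ`,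
obtained by evaluating at the elements `aⱼ` dual to the `χⱼ`. -/
def structConst (i k j : Fin 4) : ℂ := quantumBracket (X.chi i) (X.chi k) (coord h g j)

/-- The relations `χᵢ χₖ = ∑ Λ_{st,ik} χₛ χₜ + ∑ C_{ik,j} χⱼ` in the tensor algebra of the quantum
Lie algebra. -/
inductive EnvelopingRel : TensorAlgebra ℂ X.quantumLie → TensorAlgebra ℂ X.quantumLie → Prop
  | mk (i k : Fin 4) : EnvelopingRel
      (TensorAlgebra.ι ℂ (X.lieBasis i) * TensorAlgebra.ι ℂ (X.lieBasis k))
      (∑ s, ∑ t, X.braid s t i k •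
          (TensorAlgebra.ι ℂ (X.lieBasis s) * TensorAlgebra.ι ℂ (X.lieBasis t)) +
        ∑ j, X.structConst i k j • TensorAlgebra.ι ℂ (X.lieBasis j))

/-- The universal enveloping algebra `U(L)`: the quotient of the tensor algebra of the quantum Lie
algebra by the two-sided ideal generated by the relations. -/
def Enveloping : Type := RingQuot X.EnvelopingRel

instance : Ring X.Enveloping := inferInstanceAs (Ring (RingQuot X.EnvelopingRel))
instance : Algebra ℂ X.Enveloping := inferInstanceAs (Algebra ℂ (RingQuot X.EnvelopingRel))

/-- The canonical map from the quantum Lie algebra to its enveloping algebra. -/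
def toEnveloping : X.quantumLie →ₗ[ℂ] X.Enveloping :=
  (RingQuot.mkAlgHom ℂ X.EnvelopingRel).toLinearMap ∘ₗ TensorAlgebra.ι ℂ

/-- The generator `χⱼ` of the enveloping algebra. -/
def χ (j : Fin 4) : X.Enveloping := X.toEnveloping (X.lieBasis j)

end CalculusMatrices

/-- The six quadratic-linear relations of the enveloping algebra of the first family. -/
structure EnvelopingRelations₁ (h g z : ℂ) {B : Type*} [Ring B] [Algebra ℂ B] (x₁ x₂ x₃ x₄ : B) :
    Prop where
  r34 : x₃ * x₄ = (z * (h + g) / (z + 1)) • x₁ ^ 2 + (h + g) ^ 2 • (x₂ * x₁) -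
    (h + g) • (x₂ * x₃) + (z * (h + g) / (z + 1)) • (x₁ * x₄) - (z / (z + 1)) • (x₁ * x₃) +
    (1 / (z + 1)) • (x₄ * x₃) + ((h + g) / (z + 1)) • x₁ - (1 / (z + 1)) • x₃
  r31 : x₃ * x₁ = -(z * (h + g) / (z + 1)) • x₁ ^ 2 - (h + g) ^ 2 • (x₂ * x₁) +
    (h + g) • (x₂ * x₃) - (z * (h + g) / (z + 1)) • (x₁ * x₄) +
    ((2 * z + 1) / (z + 1)) • (x₁ * x₃) + (z / (z + 1)) • (x₄ * x₃) -
    ((h + g) / (z + 1)) • x₁ + (1 / (z + 1)) • x₃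
  r32 : x₃ * x₂ = (z / (z + 1)) • x₄ ^ 2 - (z / (z + 1)) • x₁ ^ 2 - (h + g) ^ 2 • x₂ ^ 2 -
    ((2 * z + 1) * (h + g) / (z + 1)) • (x₂ * x₁) + ((h + g) / (z + 1)) • (x₂ * x₄) + x₂ * x₃ -
    (1 / (z + 1)) • x₁ - ((h + g) / (z + 1)) • x₂ + (1 / (z + 1)) • x₄
  r41 : x₄ * x₁ = x₁ * x₄
  r42 : x₄ * x₂ = -(h + g) • x₂ ^ 2 - (z / (z + 1)) • (x₂ * x₁) + (1 / (z + 1)) • (x₂ * x₄) -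
    (1 / (z + 1)) • x₂
  r12 : x₁ * x₂ = (h + g) • x₂ ^ 2 + ((2 * z + 1) / (z + 1)) • (x₂ * x₁) +
    (z / (z + 1)) • (x₂ * x₄) + (1 / (z + 1)) • x₂

/-- The six quadratic-linear relations of the enveloping algebras of the second and third
families. -/
structure EnvelopingRelations₂₃ (h g : ℂ) {B : Type*} [Ring B] [Algebra ℂ B] (x₁ x₂ x₃ x₄ : B) :
    Prop where
  r34 : x₃ * x₄ = (h + g) ^ 2 • (x₂ * x₁) - (h + g) • (x₂ * x₃) + x₄ * x₃ + (h + g) • x₁ - x₃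
  r31 : x₃ * x₁ = -(h + g) ^ 2 • (x₂ * x₁) + (h + g) • (x₂ * x₃) + x₁ * x₃ - (h + g) • x₁ + x₃
  r32 : x₃ * x₂ = -(h + g) ^ 2 • x₂ ^ 2 - (h + g) • (x₂ * x₁) + (h + g) • (x₂ * x₄) + x₂ * x₃ -
    x₁ - (h + g) • x₂ + x₄
  r41 : x₄ * x₁ = x₁ * x₄
  r42 : x₄ * x₂ = -(h + g) • x₂ ^ 2 + x₂ * x₄ - x₂
  r12 : x₁ * x₂ = (h + g) • x₂ ^ 2 + x₂ * x₁ + x₂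

/-- The ordered monomial `χ₂^α χ₁^β χ₄^γ χ₃^δ`. -/
def orderedMonomial {B : Type*} [Ring B] (x₁ x₂ x₃ x₄ : B) (m : ℕ × ℕ × ℕ × ℕ) : B :=
  x₂ ^ m.1 * x₁ ^ m.2.1 * x₄ ^ m.2.2.1 * x₃ ^ m.2.2.2

end Jordanian

end

noncomputable section

namespace Jordanian

/-! Put q = h + g and m = 1/(z + 1). Then z/(z + 1) = 1 - m and (2z + 1)/(z + 1) = 2 - m, and all
the presentations become the single family `LieRelations q m`, with m = 1 for the second and third
calculi. Since z = 0 also gives m = 1, the comparison with the first presentation is immediate.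

Presentation. Both Λ and the structure constants are values of one representation, the bordered
representation (ε χ; 0 f), on the entries v_{it} = S(T_{pr}) T_{sq} of the coaction matrix:
Λ_{st,ik} = f_{sk}(v_{it}) by definition, and C_{ik,t} = χ_k(v_{it}) by `structConst_eq`. Hence the
sixteen defining relations are read off from sixteen products of explicit bordered matrices. Linear
algebra over an arbitrary algebra then shows that they are equivalent to six of them (`braid₁_iff`,
`braid₂_iff`). As the χ_j are a basis of the quantum Lie algebra (`quantumLieBasis`), this yields
the universal property.

Basis. The relations sort every word into the order χ₂, χ₁, χ₄, χ₃, so the ordered monomials span.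
For independence a model is built in two stages. The element χ₁ + χ₄ is central, and with u = (1 -
m)(χ₁ + χ₄) + m + qχ₂ the relations without χ₃ say that χ₁ and χ₄ commute and that [χ₁, χ₂] = uχ₂ =
-[χ₄, χ₂]. They hold for operators on polynomials in p₁, p₂, p₄: χ₁ = p₁ + D, χ₂ = p₂, χ₄ = p₄ - D,
where D is the derivation p₂ ↦ u p₂ killing p₁ and p₄. The relations with χ₃ have the Ore form χ₃ a
= σ(a) χ₃ + δ(a), so χ₃ acts on coefficient sequences over the algebra of χ₁, χ₂, χ₄. Applied to the
unit vectors, distinct ordered monomials give distinct standard monomials, whose coefficient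
functionals form a dual family. -/

/-- The relations among `χ₁, χ₂, χ₄`, with `q = h + g` and `m = 1 / (z + 1)`. -/
structure BorelRelations (q m : ℂ) {B : Type*} [Ring B] [Algebra ℂ B] (x₁ x₂ x₄ : B) : Prop where
  r41 : x₄ * x₁ = x₁ * x₄
  r42 : x₄ * x₂ = -q • (x₂ * x₂) - (1 - m) • (x₂ * x₁) + m • (x₂ * x₄) - m • x₂
  r12 : x₁ * x₂ = q • (x₂ * x₂) + (2 - m) • (x₂ * x₁) + (1 - m) • (x₂ * x₄) + m • x₂

/-- The six relations of the enveloping algebras, with `q = h + g` and `m = 1 / (z + 1)`. -/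
structure LieRelations (q m : ℂ) {B : Type*} [Ring B] [Algebra ℂ B] (x₁ x₂ x₃ x₄ : B) : Prop
    extends BorelRelations q m x₁ x₂ x₄ where
  r34 : x₃ * x₄ = ((1 - m) * q) • (x₁ * x₁) + q ^ 2 • (x₂ * x₁) - q • (x₂ * x₃) +
    ((1 - m) * q) • (x₁ * x₄) - (1 - m) • (x₁ * x₃) + m • (x₄ * x₃) + (m * q) • x₁ - m • x₃
  r31 : x₃ * x₁ = -((1 - m) * q) • (x₁ * x₁) - q ^ 2 • (x₂ * x₁) + q • (x₂ * x₃) -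
    ((1 - m) * q) • (x₁ * x₄) + (2 - m) • (x₁ * x₃) + (1 - m) • (x₄ * x₃) - (m * q) • x₁ + m • x₃
  r32 : x₃ * x₂ = (1 - m) • (x₄ * x₄) - (1 - m) • (x₁ * x₁) - q ^ 2 • (x₂ * x₂) -
    ((2 - m) * q) • (x₂ * x₁) + (m * q) • (x₂ * x₄) + x₂ * x₃ - m • x₁ - (m * q) • x₂ + m • x₄

lemma envelopingRelations₁_iff {h g z : ℂ} (hz : z ≠ -1) {B : Type*} [Ring B] [Algebra ℂ B]
    {x₁ x₂ x₃ x₄ : B} : EnvelopingRelations₁ h g z x₁ x₂ x₃ x₄ ↔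
      LieRelations (h + g) (z + 1)⁻¹ x₁ x₂ x₃ x₄ := by
  have hz' : z + 1 ≠ 0 := fun H => hz (by linear_combination H)
  have e₁ : z / (z + 1) = 1 - (z + 1)⁻¹ := by field_simp; ring
  have e₂ : (2 * z + 1) / (z + 1) = 2 - (z + 1)⁻¹ := by field_simp; ring
  have e₃ : z * (h + g) / (z + 1) = (1 - (z + 1)⁻¹) * (h + g) := by field_simp; ring
  have e₄ : (h + g) / (z + 1) = (z + 1)⁻¹ * (h + g) := by field_simp
  have e₅ : (2 * z + 1) * (h + g) / (z + 1) = (2 - (z + 1)⁻¹) * (h + g) := by field_simp; ring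
  constructor
  · rintro ⟨h1, h2, h3, h4, h5, h6⟩
    simp only [e₁, e₂, e₃, e₄, e₅, one_div, pow_two x₁, pow_two x₂, pow_two x₄] at h1 h2 h3 h5 h6
    exact ⟨⟨h4, h5, h6⟩, h1, h2, h3⟩
  · rintro ⟨⟨h4, h5, h6⟩, h1, h2, h3⟩
    constructor <;>
      (try simp only [e₁, e₂, e₃, e₄, e₅, one_div, pow_two x₁, pow_two x₂, pow_two x₄]) <;>
      assumption

/-- At m = 1 every term with the factor 1 - m drops out, and 2 - m becomes 1. -/
lemma envelopingRelations₂₃_iff {h g : ℂ} {B : Type*} [Ring B] [Algebra ℂ B]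
    {x₁ x₂ x₃ x₄ : B} : EnvelopingRelations₂₃ h g x₁ x₂ x₃ x₄ ↔
      LieRelations (h + g) 1 x₁ x₂ x₃ x₄ := by
  constructor
  · rintro ⟨h1, h2, h3, h4, h5, h6⟩
    refine ⟨⟨h4, h5.trans ?_, h6.trans ?_⟩, h1.trans ?_, h2.trans ?_, h3.trans ?_⟩ <;>
      (try simp only [pow_two x₂]) <;> module
  · rintro ⟨⟨h4, h5, h6⟩, h1, h2, h3⟩
    refine ⟨h1.trans ?_, h2.trans ?_, h3.trans ?_, h4, h5.trans ?_, h6.trans ?_⟩ <;>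
      (try simp only [pow_two x₂]) <;> module

/-! ### Spanning -/

section Span

variable {q m : ℂ} {B : Type*} [Ring B] [Algebra ℂ B] {x₁ x₂ x₃ x₄ : B}

lemma orderedMonomial_mem_span (a b c d : ℕ) : x₂ ^ a * x₁ ^ b * x₄ ^ c * x₃ ^ d ∈
    Submodule.span ℂ (Set.range (orderedMonomial x₁ x₂ x₃ x₄)) :=
  Submodule.subset_span ⟨(a, b, c, d), rfl⟩

lemma x₂_mul_mem_span {y : B}
    (hy : y ∈ Submodule.span ℂ (Set.range (orderedMonomial x₁ x₂ x₃ x₄))) :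
    x₂ * y ∈ Submodule.span ℂ (Set.range (orderedMonomial x₁ x₂ x₃ x₄)) := by
  induction hy using Submodule.span_induction with
  | zero => simp
  | add y z _ _ h1 h2 => rw [mul_add]; exact add_mem h1 h2
  | smul r y _ h1 => rw [mul_smul_comm]; exact Submodule.smul_mem _ _ h1
  | mem y hy =>
    obtain ⟨⟨a, b, c, d⟩, rfl⟩ := hy
    convert orderedMonomial_mem_span (x₁ := x₁) (x₂ := x₂) (x₃ := x₃) (x₄ := x₄) (a + 1) b c d using 1
    simp only [orderedMonomial, pow_succ', mul_assoc]

/-- Moving χ₁ or χ₄ past one χ₂ leaves χ₂ on the left of terms in χ₁, χ₄, χ₂ and 1. Each of the two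
relations involves both χ₁ and χ₄, so the two memberships are proved together, by induction on the
exponent of χ₂. -/
lemma BorelRelations.mul_mem_span (H : BorelRelations q m x₁ x₂ x₄) {y : B}
    (hy : y ∈ Submodule.span ℂ (Set.range (orderedMonomial x₁ x₂ x₃ x₄))) :
    x₁ * y ∈ Submodule.span ℂ (Set.range (orderedMonomial x₁ x₂ x₃ x₄)) ∧
      x₄ * y ∈ Submodule.span ℂ (Set.range (orderedMonomial x₁ x₂ x₃ x₄)) := by
  induction hy using Submodule.span_induction with
  | zero => simp
  | add y z _ _ h1 h2 => simp only [mul_add]; exact ⟨add_mem h1.1 h2.1, add_mem h1.2 h2.2⟩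
  | smul r y _ h1 =>
    simp only [mul_smul_comm]
    exact ⟨Submodule.smul_mem _ _ h1.1, Submodule.smul_mem _ _ h1.2⟩
  | mem y hy =>
    obtain ⟨⟨a, b, c, d⟩, rfl⟩ := hy
    simp only [orderedMonomial]
    set W := Submodule.span ℂ (Set.range (orderedMonomial x₁ x₂ x₃ x₄)) with hW
    induction a with
    | zero =>
      constructor
      · convert orderedMonomial_mem_span (x₁ := x₁) (x₂ := x₂) (x₃ := x₃) (x₄ := x₄) 0 (b + 1) c d
          using 1
        simp only [pow_succ', mul_assoc, pow_zero, one_mul]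
      · convert orderedMonomial_mem_span (x₁ := x₁) (x₂ := x₂) (x₃ := x₃) (x₄ := x₄) 0 b (c + 1) d
          using 1
        -- Without χ₂, multiplication by χ₄ only has to pass the powers of χ₁, with which it
        -- commutes.
        have hc : x₄ * x₁ ^ b = x₁ ^ b * x₄ := (Commute.pow_right H.r41 b).eq
        simp only [pow_zero, one_mul, ← mul_assoc, hc]
        simp only [pow_succ', mul_assoc]
    | succ a ih =>
      set y := x₂ ^ a * x₁ ^ b * x₄ ^ c * x₃ ^ d with hy
      have e : x₂ ^ (a + 1) * x₁ ^ b * x₄ ^ c * x₃ ^ d = x₂ * y := by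
        simp only [hy, pow_succ', mul_assoc]
      have h0 : y ∈ W := orderedMonomial_mem_span a b c d
      have h1 : x₂ * (x₁ * y) ∈ W := x₂_mul_mem_span ih.1
      have h4 : x₂ * (x₄ * y) ∈ W := x₂_mul_mem_span ih.2
      have h2 : x₂ * y ∈ W := x₂_mul_mem_span h0
      have h22 : x₂ * (x₂ * y) ∈ W := x₂_mul_mem_span h2
      have e1 := congrArg (· * y) H.r12
      have e4 := congrArg (· * y) H.r42
      simp only [add_mul, sub_mul, smul_mul_assoc, mul_assoc] at e1 e4
      rw [e, e1, e4]
      constructor <;>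
      · repeat' (first | apply add_mem | apply sub_mem | apply Submodule.smul_mem)
        all_goals assumption

/-- Each relation for χ₃ rewrites χ₃x as terms in which χ₃ is absent or stands last. So if y and χ₃y
lie in the span, then so does χ₃(xy) for x = χ₁, χ₂, χ₄, because the span is already stable under
those three. -/
lemma LieRelations.mul_mem_span (H : LieRelations q m x₁ x₂ x₃ x₄) {y : B}
    (hy : y ∈ Submodule.span ℂ (Set.range (orderedMonomial x₁ x₂ x₃ x₄))) :
    x₃ * y ∈ Submodule.span ℂ (Set.range (orderedMonomial x₁ x₂ x₃ x₄)) := by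
  induction hy using Submodule.span_induction with
  | zero => simp
  | add y z _ _ h1 h2 => rw [mul_add]; exact add_mem h1 h2
  | smul r y _ h1 => rw [mul_smul_comm]; exact Submodule.smul_mem _ _ h1
  | mem y hy =>
    obtain ⟨⟨a, b, c, d⟩, rfl⟩ := hy
    simp only [orderedMonomial]
    set W := Submodule.span ℂ (Set.range (orderedMonomial x₁ x₂ x₃ x₄)) with hW
    have k1 : ∀ {y}, y ∈ W → x₁ * y ∈ W := fun hy => (H.toBorelRelations.mul_mem_span hy).1
    have k4 : ∀ {y}, y ∈ W → x₄ * y ∈ W := fun hy => (H.toBorelRelations.mul_mem_span hy).2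
    have k2 : ∀ {y}, y ∈ W → x₂ * y ∈ W := fun hy => x₂_mul_mem_span hy
    have step1 : ∀ {y}, y ∈ W → x₃ * y ∈ W → x₃ * (x₁ * y) ∈ W := by
      intro y h h'
      rw [← mul_assoc, H.r31]
      simp only [add_mul, sub_mul, smul_mul_assoc, mul_assoc]
      repeat'
        first
        | apply add_mem | apply sub_mem | apply Submodule.smul_mem | assumption
        | apply k1 | apply k2 | apply k4
    have step2 : ∀ {y}, y ∈ W → x₃ * y ∈ W → x₃ * (x₂ * y) ∈ W := by
      intro y h h'
      rw [← mul_assoc, H.r32]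
      simp only [add_mul, sub_mul, smul_mul_assoc, mul_assoc]
      repeat'
        first
        | apply add_mem | apply sub_mem | apply Submodule.smul_mem | assumption
        | apply k1 | apply k2 | apply k4
    have step4 : ∀ {y}, y ∈ W → x₃ * y ∈ W → x₃ * (x₄ * y) ∈ W := by
      intro y h h'
      rw [← mul_assoc, H.r34]
      simp only [add_mul, sub_mul, smul_mul_assoc, mul_assoc]
      repeat'
        first
        | apply add_mem | apply sub_mem | apply Submodule.smul_mem | assumption
        | apply k1 | apply k2 | apply k4
    -- The pair (y, χ₃y) is what the induction carries through a power of x.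
    have pow_step : ∀ {x : B}, (∀ {y}, y ∈ W → x * y ∈ W) →
        (∀ {y}, y ∈ W → x₃ * y ∈ W → x₃ * (x * y) ∈ W) → ∀ n {y}, y ∈ W → x₃ * y ∈ W →
          x ^ n * y ∈ W ∧ x₃ * (x ^ n * y) ∈ W := by
      intro x hx hx' n
      induction n with
      | zero => intro y h h'; simpa using ⟨h, h'⟩
      | succ n ih =>
        intro y h h'
        obtain ⟨i, i'⟩ := ih h h'
        rw [pow_succ', mul_assoc]
        exact ⟨hx i, hx' i i'⟩
    -- The monomial is rebuilt from the right: first χ₃^d, where χ₃ merely raises the exponent, then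
    -- the powers of χ₄, χ₁ and χ₂.
    have t0 : x₃ ^ d ∈ W ∧ x₃ * x₃ ^ d ∈ W := by
      constructor
      · simpa using! orderedMonomial_mem_span (x₁ := x₁) (x₂ := x₂) (x₃ := x₃) (x₄ := x₄) 0 0 0 d
      · simpa [pow_succ'] using!
          orderedMonomial_mem_span (x₁ := x₁) (x₂ := x₂) (x₃ := x₃) (x₄ := x₄) 0 0 0 (d + 1)
    have t1 := pow_step k4 step4 c t0.1 t0.2
    have t2 := pow_step k1 step1 b t1.1 t1.2
    have t3 := pow_step k2 step2 a t2.1 t2.2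
    simpa only [mul_assoc] using t3.2

lemma LieRelations.span_eq_top (H : LieRelations q m x₁ x₂ x₃ x₄)
    (hgen : Algebra.adjoin ℂ {x₁, x₂, x₃, x₄} = ⊤) :
    Submodule.span ℂ (Set.range (orderedMonomial x₁ x₂ x₃ x₄)) = ⊤ := by
  set W := Submodule.span ℂ (Set.range (orderedMonomial x₁ x₂ x₃ x₄)) with hW
  -- The span is a left ideal of the subalgebra generated by the four elements; since it contains 1,
  -- it is everything.
  have key : ∀ x ∈ Algebra.adjoin ℂ {x₁, x₂, x₃, x₄}, ∀ y ∈ W, x * y ∈ W := by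
    intro x hx
    induction hx using Algebra.adjoin_induction with
    | mem x hx =>
      rcases hx with rfl | rfl | rfl | rfl
      · exact fun y hy => (H.toBorelRelations.mul_mem_span hy).1
      · exact fun y hy => x₂_mul_mem_span hy
      · exact fun y hy => H.mul_mem_span hy
      · exact fun y hy => (H.toBorelRelations.mul_mem_span hy).2
    | algebraMap r => intro y hy; rw [← Algebra.smul_def]; exact W.smul_mem r hy
    | add x x' _ _ h1 h2 => intro y hy; rw [add_mul]; exact add_mem (h1 y hy) (h2 y hy)
    | mul x x' _ _ h1 h2 => intro y hy; rw [mul_assoc]; exact h1 _ (h2 y hy)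
  rw [eq_top_iff]
  intro x _
  have h1 : (1 : B) ∈ W := by
    simpa using! orderedMonomial_mem_span (x₁ := x₁) (x₂ := x₂) (x₃ := x₃) (x₄ := x₄) 0 0 0 0
  simpa using key x (hgen ▸ Algebra.mem_top) 1 h1

end Span

/-! ### Linear independence -/

/-- The relations `BorelRelations` in the free algebra on three generators, standing for
`χ₁, χ₂, χ₄`. -/
inductive BorelRel (q m : ℂ) : FreeAlgebra ℂ (Fin 3) → FreeAlgebra ℂ (Fin 3) → Prop
  | r41 : BorelRel q m (FreeAlgebra.ι ℂ 2 * FreeAlgebra.ι ℂ 0)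
      (FreeAlgebra.ι ℂ 0 * FreeAlgebra.ι ℂ 2)
  | r42 : BorelRel q m (FreeAlgebra.ι ℂ 2 * FreeAlgebra.ι ℂ 1)
      (-q • (FreeAlgebra.ι ℂ 1 * FreeAlgebra.ι ℂ 1) -
        (1 - m) • (FreeAlgebra.ι ℂ 1 * FreeAlgebra.ι ℂ 0) +
        m • (FreeAlgebra.ι ℂ 1 * FreeAlgebra.ι ℂ 2) - m • FreeAlgebra.ι ℂ 1)
  | r12 : BorelRel q m (FreeAlgebra.ι ℂ 0 * FreeAlgebra.ι ℂ 1)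
      (q • (FreeAlgebra.ι ℂ 1 * FreeAlgebra.ι ℂ 1) +
        (2 - m) • (FreeAlgebra.ι ℂ 1 * FreeAlgebra.ι ℂ 0) +
        (1 - m) • (FreeAlgebra.ι ℂ 1 * FreeAlgebra.ι ℂ 2) + m • FreeAlgebra.ι ℂ 1)

/-- The algebra presented by `BorelRelations`. -/
def Borel (q m : ℂ) : Type := RingQuot (BorelRel q m)

namespace Borel

variable {q m : ℂ}

instance : Ring (Borel q m) := inferInstanceAs (Ring (RingQuot (BorelRel q m)))
instance : Algebra ℂ (Borel q m) := inferInstanceAs (Algebra ℂ (RingQuot (BorelRel q m)))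

variable (q m) in
/-- The generators of `Borel q m`. -/
def gen (i : Fin 3) : Borel q m := RingQuot.mkAlgHom ℂ (BorelRel q m) (FreeAlgebra.ι ℂ i)

lemma relations : BorelRelations q m (gen q m 0) (gen q m 1) (gen q m 2) := by
  constructor
  · simpa [gen] using! RingQuot.mkAlgHom_rel ℂ (BorelRel.r41 (q := q) (m := m))
  · simpa only [map_add, map_sub, map_smul, map_mul] using!
      RingQuot.mkAlgHom_rel ℂ (BorelRel.r42 (q := q) (m := m))
  · simpa only [map_add, map_sub, map_smul, map_mul] using!
      RingQuot.mkAlgHom_rel ℂ (BorelRel.r12 (q := q) (m := m))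

/-- The universal property of `Borel q m`. -/
def lift {B : Type*} [Ring B] [Algebra ℂ B] {x₁ x₂ x₄ : B} (H : BorelRelations q m x₁ x₂ x₄) :
    Borel q m →ₐ[ℂ] B :=
  RingQuot.liftAlgHom ℂ ⟨FreeAlgebra.lift ℂ ![x₁, x₂, x₄], by
    rintro _ _ (_ | _ | _)
    · simpa using H.r41
    · simpa using H.r42
    · simpa using H.r12⟩

lemma lift_gen {B : Type*} [Ring B] [Algebra ℂ B] {x₁ x₂ x₄ : B}
    (H : BorelRelations q m x₁ x₂ x₄) (i : Fin 3) : lift H (gen q m i) = ![x₁, x₂, x₄] i := by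
  unfold lift gen
  refine (RingQuot.liftAlgHom_mkAlgHom_apply _ _ _ _).trans ?_
  simp

lemma induction {p : Borel q m → Prop} (hgen : ∀ i, p (gen q m i))
    (halg : ∀ r : ℂ, p (algebraMap ℂ _ r)) (hmul : ∀ x y, p x → p y → p (x * y))
    (hadd : ∀ x y, p x → p y → p (x + y)) (x : Borel q m) : p x := by
  obtain ⟨y, rfl⟩ := RingQuot.mkAlgHom_surjective ℂ (BorelRel q m) x
  induction y using FreeAlgebra.induction with
  | grade0 r => simpa using! halg r
  | grade1 r => exact hgen r
  | mul _ _ h1 h2 => simpa using! hmul _ _ h1 h2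
  | add _ _ h1 h2 => simpa using! hadd _ _ h1 h2

/-! ### Polynomial representation of the algebra of χ₁, χ₂, χ₄ -/

open MvPolynomial

variable (q m) in
/-- The polynomial `u` in the commutation relation `[χ₁, χ₂] = u χ₂`. -/
def uPoly : MvPolynomial (Fin 3) ℂ :=
  (1 - m) • (X 0 + X 2) + m • 1 + q • X 1

variable (q m) in
/-- The derivation `p₂ ↦ u p₂` of the polynomial ring in the variables `p₁, p₂, p₄`. -/
def der : Derivation ℂ (MvPolynomial (Fin 3) ℂ) (MvPolynomial (Fin 3) ℂ) :=
  MvPolynomial.mkDerivation ℂ ![0, uPoly q m * X 1, 0]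

lemma der_X (i : Fin 3) : der q m (X i) = ![0, uPoly q m * X 1, 0] i :=
  MvPolynomial.mkDerivation_X _ _ _

/-- The derivation D kills p₁ and p₄, so it commutes with multiplication by them; hence p₁ + D and
p₄ - D commute and their sum is multiplication by p₁ + p₄. The other two relations both amount to
[D, p₂] = u p₂. -/
lemma polynomial_relations : BorelRelations q m
    (Algebra.lmul ℂ (MvPolynomial (Fin 3) ℂ) (X 0) + (der q m).toLinearMap : Module.End ℂ _)
    (Algebra.lmul ℂ (MvPolynomial (Fin 3) ℂ) (X 1))
    (Algebra.lmul ℂ (MvPolynomial (Fin 3) ℂ) (X 2) - (der q m).toLinearMap) := by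
  constructor <;>
  · refine LinearMap.ext fun p => ?_
    simp [der_X, -neg_smul]
    try simp only [uPoly, smul_eq_C_mul, map_sub, map_one, map_ofNat, map_neg]
    ring

variable (q m) in
/-- The action of `Borel q m` on polynomials. -/
def toEnd : Borel q m →ₐ[ℂ] Module.End ℂ (MvPolynomial (Fin 3) ℂ) := lift polynomial_relations

end Borel

namespace Borel

variable {q m : ℂ}

open MvPolynomial

/-- As D vanishes on polynomials in p₁ and p₄, the powers of χ₄ and then of χ₁ act on 1 without
correction terms. This is why χ₂, the only variable that D moves, stands leftmost. -/
lemma toEnd_apply_one (a b c : ℕ) :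
    toEnd q m (gen q m 1 ^ a * gen q m 0 ^ b * gen q m 2 ^ c) 1 = X 1 ^ a * X 0 ^ b * X 2 ^ c := by
  have h4 : ∀ c, (toEnd q m (gen q m 2) ^ c) 1 = X 2 ^ c := by
    intro c
    induction c with
    | zero => simp
    | succ c ih =>
      rw [pow_succ', Module.End.mul_apply, ih]
      simp [toEnd, lift_gen, der_X, Derivation.leibniz_pow, pow_succ']
  have h1 : ∀ b, (toEnd q m (gen q m 0) ^ b) (X 2 ^ c) = X 0 ^ b * X 2 ^ c := by
    intro b
    induction b with
    | zero => simp
    | succ b ih =>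
      rw [pow_succ', Module.End.mul_apply, ih]
      simp [toEnd, lift_gen, der_X, Derivation.leibniz_pow, pow_succ', mul_assoc]
  have h2 : ∀ (a : ℕ) (p : MvPolynomial (Fin 3) ℂ), (toEnd q m (gen q m 1) ^ a) p = X 1 ^ a * p := by
    intro a p
    induction a with
    | zero => simp
    | succ a ih =>
      rw [pow_succ', Module.End.mul_apply, ih]
      simp [toEnd, lift_gen, pow_succ', mul_assoc]
  rw [map_mul, map_mul, map_pow, map_pow, map_pow, Module.End.mul_apply, Module.End.mul_apply, h4,
    h1, h2, mul_assoc]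

/-! ### The Ore extension by χ₃ -/

set_option linter.unusedSimpArgs false in
/-- The matrices `(σ(a), δ(a); 0, a)` for the generators `a`, where `χ₃ a = σ(a) χ₃ + δ(a)`. -/
lemma ore_relations {B : Type*} [Ring B] [Algebra ℂ B] {x₁ x₂ x₄ : B}
    (H : BorelRelations q m x₁ x₂ x₄) : BorelRelations q m (B := Matrix (Fin 2) (Fin 2) B)
      !![x₁ + ((1 - m) • (x₁ + x₄) + m • 1 + q • x₂),
        -q • (((1 - m) • (x₁ + x₄) + m • 1 + q • x₂) * x₁); 0, x₁]
      !![x₂, (1 - m) • (x₄ * x₄) - (1 - m) • (x₁ * x₁) - q ^ 2 • (x₂ * x₂) -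
        ((2 - m) * q) • (x₂ * x₁) + (m * q) • (x₂ * x₄) - m • x₁ - (m * q) • x₂ + m • x₄; 0, x₂]
      !![x₄ - ((1 - m) • (x₁ + x₄) + m • 1 + q • x₂),
        q • (((1 - m) • (x₁ + x₄) + m • 1 + q • x₂) * x₁); 0, x₄] := by
  -- Together with the relations themselves, these versions with a trailing factor sort all words
  -- into the order χ₂, χ₁, χ₄; coefficients can then be compared.
  have h41 : ∀ x, x₄ * (x₁ * x) = _ := fun x => by rw [← mul_assoc, H.r41]
  have h42 : ∀ x, x₄ * (x₂ * x) = _ := fun x => by rw [← mul_assoc, H.r42]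
  have h12 : ∀ x, x₁ * (x₂ * x) = _ := fun x => by rw [← mul_assoc, H.r12]
  constructor <;>
  · simp only [Matrix.mul_fin_two, Matrix.smul_of, Matrix.smul_cons, Matrix.smul_empty]
    ext i j
    fin_cases i <;> fin_cases j <;>
      simp <;>
      · simp only [mul_add, add_mul, mul_sub, sub_mul, mul_assoc, H.r41, H.r42, H.r12, h41, h42,
          h12, smul_mul_assoc, mul_smul_comm, smul_add, smul_sub, neg_mul, mul_neg, one_mul,
          mul_one, smul_neg]
        try module

variable (q m) in
/-- The algebra map `a ↦ (σ(a), δ(a); 0, a)`. -/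
def ore : Borel q m →ₐ[ℂ] Matrix (Fin 2) (Fin 2) (Borel q m) := lift (ore_relations relations)

lemma ore_eq (a : Borel q m) : ore q m a 1 0 = 0 ∧ ore q m a 1 1 = a := by
  induction a using induction with
  | hgen i => rw [ore, lift_gen]; fin_cases i <;> simp
  | halg r => simp [Matrix.algebraMap_matrix_apply]
  | hmul a b ha hb => simp [Matrix.mul_apply, Fin.sum_univ_two, ha, hb]
  | hadd a b ha hb => simp [ha, hb]

/-- Multiplicativity of the triangular matrices says that σ is an endomorphism and that δ(ab) =
σ(a)δ(b) + δ(a)b. Hence σ and δ exist as soon as the relations are checked on generators, with no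
separate extension argument for twisted derivations. -/
lemma ore_mul (a b : Borel q m) : ore q m (a * b) 0 0 = ore q m a 0 0 * ore q m b 0 0 ∧
    ore q m (a * b) 0 1 = ore q m a 0 0 * ore q m b 0 1 + ore q m a 0 1 * b := by
  simp [Matrix.mul_apply, Fin.sum_univ_two, ore_eq]

variable (q m) in
/-- The action of `χ₃` on the coefficient sequences of left polynomials in `χ₃`. -/
def shift : Module.End ℂ (ℕ → Borel q m) where
  -- This is χ₃ · sₙχ₃ⁿ = σ(sₙ)χ₃ⁿ⁺¹ + δ(sₙ)χ₃ⁿ collected by degree; degree 0 receives no σ term,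
  -- whence the default value 0.
  toFun s n := ore q m (s n) 0 1 + Nat.casesOn n 0 (fun k => ore q m (s k) 0 0)
  map_add' s t := by
    ext n
    cases n <;> simp
    abel
  map_smul' r s := by
    ext n
    cases n <;> simp

lemma shift_zero (s : ℕ → Borel q m) : shift q m s 0 = ore q m (s 0) 0 1 := add_zero _

lemma shift_succ (s : ℕ → Borel q m) (n : ℕ) :
    shift q m s (n + 1) = ore q m (s (n + 1)) 0 1 + ore q m (s n) 0 0 := rfl

/-- The Ore rule χ₃ a = σ(a) χ₃ + δ(a) as an identity of operators; in each degree it is `ore_mul`.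
-/
lemma shift_comp (a : Borel q m) : shift q m * Algebra.lsmul ℂ ℂ (ℕ → Borel q m) a =
    Algebra.lsmul ℂ ℂ (ℕ → Borel q m) (ore q m a 0 0) * shift q m +
      Algebra.lsmul ℂ ℂ (ℕ → Borel q m) (ore q m a 0 1) := by
  refine LinearMap.ext fun s => ?_
  ext n
  cases n <;> simp [shift_zero, shift_succ, ore_mul, -map_mul, mul_add]
  abel

lemma shift_pow (d : ℕ) : (shift q m ^ d) (Pi.single 0 1) = Pi.single d 1 := by
  induction d with
  | zero => simp
  | succ d ih =>
    rw [pow_succ', Module.End.mul_apply, ih]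
    -- The map `ore` sends 1 to 1 and 0 to 0, so σ(1) = 1 and δ(1) = 0: χ₃ moves the unit
    -- coefficient up one degree.
    have h : ∀ n k, ore q m ((Pi.single n 1 : ℕ → Borel q m) k) =
        if k = n then 1 else 0 := fun n k => by
      by_cases h : k = n <;> simp [h]
    ext n
    cases n with
    | zero =>
      rw [shift_zero, h]
      split_ifs <;> simp
    | succ n =>
      rw [shift_succ, h, h]
      by_cases h1 : n = d <;> by_cases h2 : n + 1 = d <;> simp [h1, h2]

lemma lsmul_pow_single (x : Borel q m) (a d : ℕ) (y : Borel q m) :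
    (Algebra.lsmul ℂ ℂ (ℕ → Borel q m) x ^ a) (Pi.single d y) = Pi.single d (x ^ a * y) := by
  rw [← map_pow, Algebra.lsmul_coe, ← smul_eq_mul, Pi.single_smul]

/-- The relations with χ₃ are `shift_comp` at the three generators; the others hold because left
multiplication is a representation. -/
lemma shift_relations : LieRelations q m (Algebra.lsmul ℂ ℂ (ℕ → Borel q m) (gen q m 0))
    (Algebra.lsmul ℂ ℂ (ℕ → Borel q m) (gen q m 1)) (shift q m)
    (Algebra.lsmul ℂ ℂ (ℕ → Borel q m) (gen q m 2)) := by
  have H := relations (q := q) (m := m)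
  have hB : BorelRelations q m (Algebra.lsmul ℂ ℂ (ℕ → Borel q m) (gen q m 0))
    (Algebra.lsmul ℂ ℂ (ℕ → Borel q m) (gen q m 1))
    (Algebra.lsmul ℂ ℂ (ℕ → Borel q m) (gen q m 2)) := by
    constructor
    · rw [← map_mul, H.r41, map_mul]
    · rw [← map_mul, H.r42]; simp only [map_add, map_sub, map_smul, map_mul]
    · rw [← map_mul, H.r12]; simp only [map_add, map_smul, map_mul]
  refine ⟨hB, ?_, ?_, ?_⟩
  all_goals
    rw [shift_comp, ore, lift_gen]
    simp only [Matrix.of_apply, Matrix.cons_val, map_add, map_sub, map_smul, map_mul, map_one,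
      add_mul, sub_mul, smul_mul_assoc, one_mul, smul_add, hB.r41]
    module

end Borel

/-- An algebra presented by `LieRelations` has a basis of ordered monomials. -/
theorem LieRelations.exists_basis {q m : ℂ} {U : Type*} [Ring U] [Algebra ℂ U] {x₁ x₂ x₃ x₄ : U}
    (H : LieRelations q m x₁ x₂ x₃ x₄) (hgen : Algebra.adjoin ℂ {x₁, x₂, x₃, x₄} = ⊤)
    (hlift : ∀ (B : Type) [Ring B] [Algebra ℂ B] (y₁ y₂ y₃ y₄ : B), LieRelations q m y₁ y₂ y₃ y₄ →
      ∃ φ : U →ₐ[ℂ] B, φ x₁ = y₁ ∧ φ x₂ = y₂ ∧ φ x₃ = y₃ ∧ φ x₄ = y₄) :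
    ∃ b : Module.Basis (ℕ × ℕ × ℕ × ℕ) ℂ U, ∀ n, b n = orderedMonomial x₁ x₂ x₃ x₄ n := by
  obtain ⟨φ, h1, h2, h3, h4⟩ := hlift _ _ _ _ _ (Borel.shift_relations (q := q) (m := m))
  -- The indices 0, 1, 2 stand for χ₁, χ₂, χ₄, so the first exponent, that of χ₂, goes to variable
  -- 1.
  let e (n : ℕ × ℕ × ℕ) : Fin 3 →₀ ℕ :=
    Finsupp.single 1 n.1 + Finsupp.single 0 n.2.1 + Finsupp.single 2 n.2.2
  have he : Function.Injective e := by
    rintro ⟨a, b, c⟩ ⟨a', b', c'⟩ h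
    have h0 := DFunLike.congr_fun h 0
    have h1 := DFunLike.congr_fun h 1
    have h2 := DFunLike.congr_fun h 2
    simp [e] at h0 h1 h2
    simp [h0, h1, h2]
  -- The dual functional: act on the sequence 1, 0, 0, …, take the term of degree equal to the
  -- exponent of χ₃, let it act on the polynomial 1, and read off one coefficient.
  let f (n : ℕ × ℕ × ℕ × ℕ) : Module.Dual ℂ U :=
    MvPolynomial.lcoeff ℂ (e (n.1, n.2.1, n.2.2.1)) ∘ₗ
      LinearMap.applyₗ (1 : MvPolynomial (Fin 3) ℂ) ∘ₗ (Borel.toEnd q m).toLinearMap ∘ₗ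
      LinearMap.proj n.2.2.2 ∘ₗ LinearMap.applyₗ (Pi.single 0 1) ∘ₗ φ.toLinearMap
  have hf : ∀ n n', f n (orderedMonomial x₁ x₂ x₃ x₄ n') = if n = n' then 1 else 0 := by
    rintro ⟨a, b, c, d⟩ ⟨a', b', c', d'⟩
    have k1 : φ (orderedMonomial x₁ x₂ x₃ x₄ (a', b', c', d')) (Pi.single 0 1) =
        Pi.single d' (Borel.gen q m 1 ^ a' * Borel.gen q m 0 ^ b' * Borel.gen q m 2 ^ c') := by
      simp only [orderedMonomial, map_mul, map_pow, h1, h2, h3, h4]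
      simp only [Module.End.mul_apply, Borel.shift_pow, Borel.lsmul_pow_single, mul_one, mul_assoc]
    simp only [f, LinearMap.comp_apply, AlgHom.toLinearMap_apply, LinearMap.applyₗ_apply_apply, k1,
      LinearMap.proj_apply]
    by_cases h : d = d'
    · subst h
      rw [Pi.single_eq_same, Borel.toEnd_apply_one]
      have k2 : (MvPolynomial.X 1 ^ a' * MvPolynomial.X 0 ^ b' * MvPolynomial.X 2 ^ c' :
          MvPolynomial (Fin 3) ℂ) = MvPolynomial.monomial (e (a', b', c')) 1 := by
        simp [e, MvPolynomial.X_pow_eq_monomial, MvPolynomial.monomial_mul]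
      rw [k2, MvPolynomial.lcoeff_apply, MvPolynomial.coeff_monomial]
      simp [he.eq_iff, eq_comm]
    · rw [Pi.single_eq_of_ne h]
      simp [h]
  have hli : LinearIndependent ℂ (orderedMonomial x₁ x₂ x₃ x₄) :=
    LinearIndependent.of_pairwise_dual_eq_zero_one _ f
      (fun n n' h => by simp [hf, h]) (fun n => by simp [hf])
  exact ⟨Module.Basis.mk hli (H.span_eq_top hgen).ge, fun n => by simp⟩

/-! ### The quantum Lie algebra and the universal property of its enveloping algebra -/

section

open scoped TensorProduct
open JGL

variable {h g : ℂ}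

namespace CalculusMatrices

variable (X : CalculusMatrices h g)

lemma chi_coord (i j : Fin 4) : X.chi i (coord h g j) = if i = j then 1 else 0 := by
  fin_cases i <;> fin_cases j <;> simp [coord, chi_gen, chi_one, genValue]

lemma linearIndependent_lieBasis : LinearIndependent ℂ X.lieBasis := by
  refine LinearIndependent.of_pairwise_dual_eq_zero_one _
    (fun j => (Module.Dual.eval ℂ _ (coord h g j)) ∘ₗ X.quantumLie.subtype) ?_ ?_
  · intro i j hij
    simp [lieBasis, chi_coord, hij.symm]
  · intro i
    simp [lieBasis, chi_coord]

/-- The elements a_j lie in ker ε and are dual to the χ_j, so subtracting ε(x)1 and Σ χ_j(x) a_j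
from x leaves an element of the annihilated subspace. A functional that kills this subspace and 1 is
therefore Σ φ(a_j) χ_j. -/
lemma span_lieBasis : ⊤ ≤ Submodule.span ℂ (Set.range X.lieBasis) := by
  rintro ⟨φ, hφ⟩ -
  have hφ' := (Submodule.mem_dualAnnihilator φ).mp hφ
  have h1 : φ 1 = 0 := hφ' 1 (Submodule.mem_sup_left (Submodule.mem_span_singleton_self 1))
  have key : ∀ x, φ x = ∑ j, φ (coord h g j) * X.chi j x := by
    intro x
    have hx : x - Coalgebra.counit (R := ℂ) x • (1 : JGL h g) -
        ∑ j, X.chi j x • coord h g j ∈ X.annihilated := by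
      refine ⟨?_, ?_⟩
      · simp [Fin.sum_univ_four, coord, counit_gen, genValue]
      · change invProj h g (X.differential _) = 0
        rw [invProj_differential]
        ext j
        simp [chi_one, chi_coord]
    have := hφ' _ (Submodule.mem_sup_right hx)
    simp only [map_sub, map_smul, h1, map_sum, smul_eq_mul, mul_zero, sub_zero, sub_eq_zero] at this
    rw [this]
    exact Finset.sum_congr rfl fun j _ => mul_comm _ _
  have e : (⟨φ, hφ⟩ : X.quantumLie) = ∑ j, φ (coord h g j) • X.lieBasis j := by
    ext x
    simp [key x, lieBasis]
  rw [e]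
  exact Submodule.sum_mem _ fun j _ => Submodule.smul_mem _ _ (Submodule.subset_span ⟨j, rfl⟩)

/-- The `χⱼ` form a basis of the quantum Lie algebra. -/
def quantumLieBasis : Module.Basis (Fin 4) ℂ X.quantumLie :=
  Module.Basis.mk X.linearIndependent_lieBasis X.span_lieBasis

lemma quantumLieBasis_apply (j : Fin 4) : X.quantumLieBasis j = X.lieBasis j := by
  simp [quantumLieBasis]

/-- The defining relations of the enveloping algebra, for four elements of an algebra. -/
def IsEnveloping {B : Type*} [Ring B] [Algebra ℂ B] (x : Fin 4 → B) : Prop :=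
  ∀ i k, x i * x k = ∑ s, ∑ t, X.braid s t i k • (x s * x t) + ∑ j, X.structConst i k j • x j

lemma isEnveloping_χ : X.IsEnveloping X.χ := by
  intro i k
  simpa only [map_mul, map_add, map_sum, map_smul] using!
    RingQuot.mkAlgHom_rel ℂ (EnvelopingRel.mk (X := X) i k)

lemma adjoin_χ : Algebra.adjoin ℂ (Set.range X.χ) = ⊤ := by
  rw [eq_top_iff]
  rintro x -
  obtain ⟨y, rfl⟩ := RingQuot.mkAlgHom_surjective ℂ X.EnvelopingRel x
  induction y using TensorAlgebra.induction with
  | algebraMap r =>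
    rw [AlgHom.commutes]
    exact algebraMap_mem (Algebra.adjoin ℂ (Set.range X.χ)) r
  | ι v =>
    rw [← X.quantumLieBasis.sum_repr v]
    simp only [map_sum, map_smul, quantumLieBasis_apply]
    refine sum_mem fun j _ => Subalgebra.smul_mem _ ?_ _
    exact Algebra.subset_adjoin ⟨j, rfl⟩
  | mul a b ha hb => rw [map_mul]; exact mul_mem ha hb
  | add a b ha hb => rw [map_add]; exact add_mem ha hb

/-- The universal property of the enveloping algebra. -/
lemma existsUnique_lift {B : Type*} [Ring B] [Algebra ℂ B] {x : Fin 4 → B}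
    (H : X.IsEnveloping x) : ∃! φ : X.Enveloping →ₐ[ℂ] B, ∀ j, φ (X.χ j) = x j := by
  have hι : ∀ j, TensorAlgebra.lift ℂ (X.quantumLieBasis.constr ℂ x)
      (TensorAlgebra.ι ℂ (X.lieBasis j)) = x j := fun j => by
    rw [TensorAlgebra.lift_ι_apply, ← quantumLieBasis_apply, Module.Basis.constr_basis]
  refine ⟨RingQuot.liftAlgHom ℂ ⟨TensorAlgebra.lift ℂ (X.quantumLieBasis.constr ℂ x), ?_⟩, ?_, ?_⟩
  · rintro _ _ ⟨i, k⟩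
    simp only [map_mul, map_add, map_sum, map_smul, hι]
    exact H i k
  · intro j
    exact (RingQuot.liftAlgHom_mkAlgHom_apply _ _ _ _).trans (hι j)
  · intro ψ hψ
    refine AlgHom.ext_of_adjoin_eq_top X.adjoin_χ ?_
    rintro _ ⟨j, rfl⟩
    exact (hψ j).trans ((RingQuot.liftAlgHom_mkAlgHom_apply _ _ _ _).trans (hι j)).symm

/-- The universal property in terms of `LieRelations`. -/
lemma existsUnique_lift_of_iff {q m : ℂ} {B : Type*} [Ring B] [Algebra ℂ B]
    (H : ∀ x : Fin 4 → B, X.IsEnveloping x ↔ LieRelations q m (x 0) (x 1) (x 2) (x 3))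
    {x₁ x₂ x₃ x₄ : B} (hx : LieRelations q m x₁ x₂ x₃ x₄) :
    ∃! φ : X.Enveloping →ₐ[ℂ] B,
      φ (X.χ 0) = x₁ ∧ φ (X.χ 1) = x₂ ∧ φ (X.χ 2) = x₃ ∧ φ (X.χ 3) = x₄ := by
  simpa [Fin.forall_fin_succ] using X.existsUnique_lift ((H ![x₁, x₂, x₃, x₄]).mpr hx)

/-- If `LieRelations` present the enveloping algebra, then the ordered monomials form a basis. -/
lemma exists_basis_of_iff {q m : ℂ}
    (H : ∀ {B : Type} [Ring B] [Algebra ℂ B] (x : Fin 4 → B),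
      X.IsEnveloping x ↔ LieRelations q m (x 0) (x 1) (x 2) (x 3)) :
    ∃ b : Module.Basis (ℕ × ℕ × ℕ × ℕ) ℂ X.Enveloping,
      ∀ n, b n = orderedMonomial (X.χ 0) (X.χ 1) (X.χ 2) (X.χ 3) n := by
  refine ((H _).mp X.isEnveloping_χ).exists_basis ?_ fun B _ _ y₁ y₂ y₃ y₄ hy =>
    (X.existsUnique_lift_of_iff H hy).exists
  rw [← X.adjoin_χ]
  congr 1
  ext x
  simp [Fin.exists_fin_succ, eq_comm]

/-- The quantum Lie bracket in terms of the matrix `V` of the right coaction. -/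
lemma structConst_eq (i k j : Fin 4) :
    X.structConst i k j = X.chi k (coactionMatrix h g i j) := by
  -- Needed because two of the a_j are a - 1 and d - 1: the unit contributes χ_i(1)χ_k(1) = 0.
  have h1 : adCoaction (JGL h g) 1 = 1 ⊗ₜ 1 := by
    simp [adCoaction, Algebra.TensorProduct.one_def]
  rw [structConst, quantumBracket, coord]
  fin_cases j <;>
  · simp [h1, chi_one]
    simp [adCoaction, comul_gen, genValue, TensorProduct.tmul_add, chi_gen]
    fin_cases i <;> simp [coactionMatrix]

/-- The relation `χᵢ χₖ = ∑ₜ (χ f(vᵢₜ))ₖ χₜ + ∑ⱼ χₖ(vᵢⱼ) χⱼ`. -/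
lemma isEnveloping_iff {B : Type*} [Ring B] [Algebra ℂ B] (x : Fin 4 → B) :
    X.IsEnveloping x ↔ ∀ i k, x i * x k =
      ∑ t, (∑ s, X.f (coactionMatrix h g i t) s k • (x s * x t) +
        X.chi k (coactionMatrix h g i t) • x t) := by
  refine forall₂_congr fun i k => ?_
  simp only [structConst_eq, Finset.sum_add_distrib]
  rw [Finset.sum_comm]
  rfl

/-- Isolates the computation specific to a calculus: once the bordered matrices of the v_{it} are
known, their f block supplies the quadratic coefficients and their χ row the linear ones. -/
lemma isEnveloping_iff_of_borderedRep {row : Fin 4 → Fin 4 → Fin 4 → ℂ}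
    {mat : Fin 4 → Fin 4 → Matrix (Fin 4) (Fin 4) ℂ} {ε : Fin 4 → Fin 4 → ℂ}
    (H : ∀ i t, X.borderedRep (coactionMatrix h g i t) = bordered (ε i t) (row i t) (mat i t))
    {B : Type*} [Ring B] [Algebra ℂ B] (x : Fin 4 → B) :
    X.IsEnveloping x ↔ ∀ i k, x i * x k =
      ∑ t, (∑ s, mat i t s k • (x s * x t) + row i t k • x t) := by
  have hf : ∀ i t, X.f (coactionMatrix h g i t) = mat i t := fun i t => by
    have := congrArg Matrix.toBlocks₂₂ ((X.borderedRep_eq _).symm.trans (H i t))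
    simpa [bordered] using this
  have hχ : ∀ i t k, X.chi k (coactionMatrix h g i t) = row i t k := fun i t k =>
    congrFun₂ (H i t) (Sum.inl 0) (Sum.inr k)
  simp only [isEnveloping_iff, hf, hχ]

end CalculusMatrices

end

/-! ### Explicit braidings and their reduction to six relations -/

section

/-- The first rows of the bordered matrices of the `vᵢₜ` for the first family, with
`m = 1 / (z + 1)`; for the third family, `m = 1`. -/
def braidRow₁ (q m : ℂ) : Fin 4 → Fin 4 → Fin 4 → ℂ :=
  ![![![0, 0, 0, 0],
      ![0, m, 0, 0],
      ![0, 0, -m, 0],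
      ![0, 0, m * q, 0]],
    ![![0, 0, m, 0],
      ![-m, 0, -m * q, m],
      ![0, 0, 0, 0],
      ![0, 0, -m, 0]],
    ![![-m * q, -m, m * q ^ 2, m * q],
      ![0, -m * q, 0, 0],
      ![m, 0, -2 * m * q, -m],
      ![0, m, m * q ^ 2, 0]],
    ![![0, 0, 0, 0],
      ![0, -m, 0, 0],
      ![0, 0, m, 0],
      ![0, 0, -m * q, 0]]]

/-- The matrices `f(vᵢₜ)` for the first family, with `m = 1 / (z + 1)`; for the third family,
`m = 1`. -/
def braidMatrix₁ (q m : ℂ) : Fin 4 → Fin 4 → Matrix (Fin 4) (Fin 4) ℂ :=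
  ![![!![1, 0, 0, 0;
      0, 1, 0, 0;
      0, 0, 1, 0;
      0, 0, 0, 1],
      !![0, 1 - m, 0, 0;
      0, q, 0, 0;
      0, 0, -q, 0;
      0, 1 - m, q ^ 2, 0],
      !![0, 0, m - 1, 0;
      0, 0, 0, 0;
      0, 0, 0, 0;
      0, 0, m - 1, 0],
      !![0, 0, q - m * q, 0;
      0, 0, 0, 0;
      0, 0, 0, 0;
      0, 0, q - m * q, 0]],
    ![!![0, 0, 1 - m, 0;
      0, 0, 0, 0;
      0, 0, 0, 0;
      0, 0, 1 - m, 0],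
      !![m, 0, m * q, 1 - m;
      -q, 1, -q ^ 2, q;
      0, 0, 1, 0;
      m - 1, 0, m * q - 2 * q, 2 - m],
      !![0, 0, 0, 0;
      0, 0, 0, 0;
      0, 0, 0, 0;
      0, 0, 0, 0],
      !![0, 0, m - 1, 0;
      0, 0, 0, 0;
      0, 0, 0, 0;
      0, 0, m - 1, 0]],
    ![!![m * q - q, m - 1, q ^ 2 - m * q ^ 2, q - m * q;
      -q ^ 2, -q, q ^ 3, q ^ 2;
      0, 0, q, 0;
      m * q - q, m - 1, -m * q ^ 2, q - m * q],
      !![0, m * q - q, 0, 0;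
      0, -q ^ 2, 0, 0;
      0, 0, -q ^ 2, 0;
      0, m * q - q, q ^ 3, 0],
      !![2 - m, 0, 2 * m * q - 3 * q, m - 1;
      q, 1, -q ^ 2, -q;
      0, 0, 1, 0;
      1 - m, 0, 2 * m * q - q, m],
      !![0, 1 - m, 2 * q ^ 2 - m * q ^ 2, 0;
      0, q, 0, 0;
      0, 0, -q, 0;
      0, 1 - m, q ^ 2 - m * q ^ 2, 0]],
    ![!![0, 0, 0, 0;
      0, 0, 0, 0;
      0, 0, 0, 0;
      0, 0, 0, 0],
      !![0, m - 1, 0, 0;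
      0, -q, 0, 0;
      0, 0, q, 0;
      0, m - 1, -q ^ 2, 0],
      !![0, 0, 1 - m, 0;
      0, 0, 0, 0;
      0, 0, 0, 0;
      0, 0, 1 - m, 0],
      !![1, 0, m * q - q, 0;
      0, 1, 0, 0;
      0, 0, 1, 0;
      0, 0, m * q - q, 1]]]

/-- The first rows of the bordered matrices of the `vᵢₜ` for the second family. -/
def braidRow₂ (q z : ℂ) : Fin 4 → Fin 4 → Fin 4 → ℂ :=
  ![![![z, 0, z * q, z],
      ![0, 1, 0, 0],
      ![0, 0, -1, 0],
      ![-z, 0, q - z * q, -z]],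
    ![![0, 0, 1, 0],
      ![2 * z - 1, 0, 2 * z * q - q, 1 + 2 * z],
      ![0, 0, 0, 0],
      ![0, 0, -1, 0]],
    ![![-q - z * q, -1, q ^ 2 - z * q ^ 2, q - z * q],
      ![0, -q, 0, 0],
      ![1 + 2 * z, 0, 2 * z * q - 2 * q, 2 * z - 1],
      ![-z * q, 1, q ^ 2 - z * q ^ 2, -z * q]],
    ![![-z, 0, -z * q, -z],
      ![0, -1, 0, 0],
      ![0, 0, 1, 0],
      ![z, 0, z * q - q, z]]]

/-- The matrices `f(vᵢₜ)` for the second family. -/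
def braidMatrix₂ (q z : ℂ) : Fin 4 → Fin 4 → Matrix (Fin 4) (Fin 4) ℂ :=
  ![![!![1, 0, 0, 0;
      z * q, 1, z * q ^ 2, z * q;
      0, 0, 1, 0;
      0, 0, 0, 1],
      !![0, 0, 0, 0;
      0, q, 0, 0;
      z, 0, z * q - q, z;
      -z * q, 0, q ^ 2 - z * q ^ 2, -z * q],
      !![0, 0, 0, 0;
      -z, 0, -z * q, -z;
      0, 0, 0, 0;
      0, 0, 0, 0],
      !![0, 0, 0, 0;
      0, 0, 0, 0;
      0, 0, 0, 0;
      0, 0, 0, 0]],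
    ![!![0, 0, 0, 0;
      z, 0, z * q, z;
      0, 0, 0, 0;
      0, 0, 0, 0],
      !![1 - z, 0, q - z * q, -z;
      2 * z * q - q, 1, 2 * z * q ^ 2 - q ^ 2, q + 2 * z * q;
      0, 0, 1, 0;
      z, 0, z * q - q, 1 + z],
      !![0, 0, 0, 0;
      0, 0, 0, 0;
      0, 0, 0, 0;
      0, 0, 0, 0],
      !![0, 0, 0, 0;
      -z, 0, -z * q, -z;
      0, 0, 0, 0;
      0, 0, 0, 0]],
    ![!![0, 0, 0, 0;
      -q ^ 2 - z * q ^ 2, -q, q ^ 3 - z * q ^ 3, q ^ 2 - z * q ^ 2;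
      -z, 0, q - z * q, -z;
      z * q, 0, z * q ^ 2 - q ^ 2, z * q],
      !![0, 0, 0, 0;
      0, -q ^ 2, 0, 0;
      z * q, 0, z * q ^ 2 - q ^ 2, z * q;
      -z * q ^ 2, 0, q ^ 3 - z * q ^ 3, -z * q ^ 2],
      !![1 + z, 0, z * q - q, z;
      q + z * q, 1, z * q ^ 2 - q ^ 2, z * q - q;
      0, 0, 1, 0;
      -z, 0, q - z * q, 1 - z],
      !![-z * q, 0, q ^ 2 - z * q ^ 2, -z * q;
      0, q, 0, 0;
      z, 0, z * q - q, z;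
      0, 0, 0, 0]],
    ![!![0, 0, 0, 0;
      -z * q, 0, -z * q ^ 2, -z * q;
      0, 0, 0, 0;
      0, 0, 0, 0],
      !![0, 0, 0, 0;
      0, -q, 0, 0;
      -z, 0, q - z * q, -z;
      z * q, 0, z * q ^ 2 - q ^ 2, z * q],
      !![0, 0, 0, 0;
      z, 0, z * q, z;
      0, 0, 0, 0;
      0, 0, 0, 0],
      !![1, 0, 0, 0;
      0, 1, 0, 0;
      0, 0, 1, 0;
      0, 0, 0, 1]]]

variable {B : Type*} [Ring B] [Algebra ℂ B] (q m z : ℂ)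

/-- Six of the sixteen relations, taken with the left sides of the presentation, already determine
all sorted products; the other ten then reduce to identities after sorting. -/
lemma braid₁_iff (x : Fin 4 → B) :
    (∀ i k, x i * x k = ∑ t, (∑ s, braidMatrix₁ q m i t s k • (x s * x t) +
      braidRow₁ q m i t k • x t)) ↔ LieRelations q m (x 0) (x 1) (x 2) (x 3) := by
  constructor
  · intro H
    have H41 := H 3 0
    have H42 := H 3 1
    have H12 := H 0 1
    have H34 := H 2 3
    have H31 := H 2 0
    have H32 := H 2 1
    simp only [Fin.sum_univ_four, braidMatrix₁, braidRow₁, Matrix.of_apply, Matrix.cons_val,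
      zero_smul, add_zero, zero_add, one_smul] at H41 H42 H12 H34 H31 H32
    refine ⟨⟨?_, ?_, ?_⟩, ?_, ?_, ?_⟩
    · linear_combination (norm := module) H41
    -- Both products χ₄χ₂ and χ₁χ₂ occur in `H42` and in `H12`. The coefficient matrix (2 - m, 1 -
    -- m; m - 1, m) has determinant 1, and its inverse gives the multipliers here and in the next
    -- line.
    · linear_combination (norm := module) m • H42 - (1 - m) • H12
    · linear_combination (norm := module) (2 - m) • H12 + (1 - m) • H42
    · linear_combination (norm := module) H34 + ((1 - m) * q) • H41
    · linear_combination (norm := module) H31 - ((1 - m) * q) • H41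
    -- The sum of `H42` and `H12` says that χ₁ + χ₄ commutes with χ₂, which sorts the terms (χ₁ +
    -- χ₄)χ₂; `H41` sorts χ₄χ₁.
    · linear_combination (norm := module) H32 - (1 - m) • H41 - ((1 - m) * q) • (H42 + H12)
  · intro H i k
    fin_cases i <;> fin_cases k <;>
    · simp only [Fin.zero_eta, Fin.mk_one, Fin.reduceFinMk, Fin.isValue, Fin.sum_univ_four,
        braidMatrix₁, braidRow₁, Matrix.of_apply, Matrix.cons_val, H.r41, H.r42, H.r12, H.r34,
        H.r31, H.r32]
      module

/-- The coefficients are affine in z, and the part proportional to z vanishes modulo the six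
relations; hence z disappears from the presentation. -/
lemma braid₂_iff (x : Fin 4 → B) :
    (∀ i k, x i * x k = ∑ t, (∑ s, braidMatrix₂ q z i t s k • (x s * x t) +
      braidRow₂ q z i t k • x t)) ↔ LieRelations q 1 (x 0) (x 1) (x 2) (x 3) := by
  constructor
  · intro H
    have H41 := H 3 0
    have H42 := H 3 1
    have H12 := H 0 1
    have H43 := H 3 2
    have H13 := H 0 2
    have H32 := H 2 1
    simp only [Fin.sum_univ_four, braidMatrix₂, braidRow₂, Matrix.of_apply, Matrix.cons_val,
      zero_smul, add_zero, zero_add, one_smul] at H41 H42 H12 H43 H13 H32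
    refine ⟨⟨?_, ?_, ?_⟩, ?_, ?_, ?_⟩
    -- `H42`, `H12` and `H32` are free of z and already in final form. In `H41` the parameter z
    -- multiplies a combination that vanishes by `H32` and `H42`.
    · linear_combination (norm := module) H41 - z • (H32 - q • H42)
    · linear_combination (norm := module) H42
    · linear_combination (norm := module) H12
    -- The relations for χ₄χ₃ and χ₁χ₃ are used instead of those for χ₃χ₄ and χ₃χ₁: each contains
    -- the wanted product once, and otherwise only χ₃χ₂ and χ₄χ₂ remain to be sorted.
    · linear_combination (norm := module) -H43 + ((z - 1) * q) • H32 + ((1 - z) * q ^ 2) • H42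
    · linear_combination (norm := module) -H13 + ((1 - z) * q) • H32 + ((z - 1) * q ^ 2) • H42
    · linear_combination (norm := module) H32
  · intro H i k
    fin_cases i <;> fin_cases k <;>
    · simp only [Fin.zero_eta, Fin.mk_one, Fin.reduceFinMk, Fin.isValue, Fin.sum_univ_four,
        braidMatrix₂, braidRow₂, Matrix.of_apply, Matrix.cons_val, H.r41, H.r42, H.r12, H.r34,
        H.r31, H.r32]
      module

end

/-! ### The bordered representation on the coaction matrix -/

section

open JGL

variable {h g : ℂ}

lemma neg₄ (a00 a01 a02 a03 a10 a11 a12 a13 a20 a21 a22 a23 a30 a31 a32 a33 : ℂ) : -!![a00,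
    a01, a02, a03; a10, a11, a12, a13; a20, a21, a22, a23; a30, a31, a32, a33] = !![-a00, -a01,
    -a02, -a03; -a10, -a11, -a12, -a13; -a20, -a21, -a22, -a23; -a30, -a31, -a32, -a33] := by
  ext i j; fin_cases i <;> fin_cases j <;> simp

lemma rowNeg₄ (x0 x1 x2 x3 : ℂ) :
    (-![x0, x1, x2, x3] : Fin 4 → ℂ) = ![-x0, -x1, -x2, -x3] := by
  ext j; fin_cases j <;> simp

lemma bordered_neg (ε : ℂ) (χ : Fin 4 → ℂ) (M : Matrix (Fin 4) (Fin 4) ℂ) :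
    -bordered ε χ M = bordered (-ε) (-χ) (-M) := by
  rw [← neg_one_smul ℂ, bordered_smul, neg_one_mul, neg_one_smul, neg_one_smul]

namespace CalculusMatrices

variable (X : CalculusMatrices h g)

lemma borderedRep_gen : X.borderedRep (gen h g .a) = bordered 1 ![1, 0, 0, 0] X.A ∧
    X.borderedRep (gen h g .b) = bordered 0 ![0, 1, 0, 0] X.B ∧
    X.borderedRep (gen h g .c) = bordered 0 ![0, 0, 1, 0] X.C ∧
    X.borderedRep (gen h g .d) = bordered 1 ![0, 0, 0, 1] X.D :=
  ⟨lift_gen _ _, lift_gen _ _, lift_gen _ _, lift_gen _ _⟩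

/-- Each S(T_{ij}) is 𝒟⁻¹x, up to sign, with x linear in the generators, and 𝒟⁻¹ has counit 1 and χ
row w; so the row of 𝒟⁻¹x is χ(x) + w f(x). -/
lemma borderedRep_antipode :
    X.borderedRep (HopfAlgebra.antipode ℂ (gen h g .a)) = bordered 1
      (![0, 0, g, 1] + Matrix.vecMul X.w (X.D + g • X.C)) (X.E * (X.D + g • X.C)) ∧
    X.borderedRep (HopfAlgebra.antipode ℂ (gen h g .b)) = bordered 0
      (![-g, -1, g * g, g] + Matrix.vecMul X.w (g • X.D - g • X.A - X.B + (g * g) • X.C))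
      (X.E * (g • X.D - g • X.A - X.B + (g * g) • X.C)) ∧
    X.borderedRep (HopfAlgebra.antipode ℂ (gen h g .c)) = bordered 0
      (-(![0, 0, 1, 0] + Matrix.vecMul X.w X.C)) (-(X.E * X.C)) ∧
    X.borderedRep (HopfAlgebra.antipode ℂ (gen h g .d)) = bordered 1
      (![1, 0, -g, 0] + Matrix.vecMul X.w (X.A - g • X.C)) (X.E * (X.A - g • X.C)) := by
  obtain ⟨ka, kb, kc, kd⟩ := X.borderedRep_gen
  have ke : X.borderedRep (gen h g .detInv) = bordered 1 X.w X.E := lift_gen _ _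
  refine ⟨?_, ?_, ?_, ?_⟩
  all_goals
    refine (congrArg _ (antipodeLin_gen _)).trans ?_
    simp only [genValue, map_mul, map_add, map_sub, map_neg, map_smul, ka, kb, kc, kd, ke,
      bordered_mul, bordered_add, bordered_sub, bordered_smul, bordered_neg, rowAdd₄, rowSub₄,
      rowSmul₄, one_smul]
    refine bordered_congr (by ring) ?_ rfl
    first
    | rfl
    | refine congrArg (· + _) ?_
      apply rowCongr₄ <;> ring

end CalculusMatrices

open CalculusMatrices

/-- In terms of m all these rows and matrices are m times polynomials in m, h, g. This factor
cancels the z + 1 that can be taken out of A, B, C, D, so that f(v_{it}) depends on z through m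
alone. -/
lemma family₁_antipode (h g z m : ℂ) (hz : z ≠ -1)
    (hm : m * (z + 1) = 1) :
      (family₁ h g z hz).borderedRep (HopfAlgebra.antipode ℂ (gen h g .a)) = bordered 1
        ![(-m - m ^ 2) / 2, 0, (m ^ 2 * g - m * g - m * h - m ^ 2 * h) / 2, (m ^ 2 - m) / 2]
        !![(m + m ^ 2) / 2, 0, (m * g + m * h + m ^ 2 * h - m ^ 2 * g) / 2, (m - m ^ 2) / 2;
          -m * h, m, -m * h ^ 2, m * h;
          0, 0, m, 0;
          (m ^ 2 - m) / 2, 0, (m * g + m ^ 2 * h - 3 * m * h - m ^ 2 * g) / 2, (3 * m - m ^ 2) / 2] ∧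
      (family₁ h g z hz).borderedRep (HopfAlgebra.antipode ℂ (gen h g .b)) = bordered 0
        ![-m ^ 2 * g, -m ^ 2, m ^ 2 * g ^ 2, m ^ 2 * g]
        !![m ^ 2 * g - m * g, m ^ 2 - m, m * g ^ 2 - m ^ 2 * g ^ 2, m * g - m ^ 2 * g;
          -m * g ^ 2 - m * h * g, -m * g - m * h, m * g ^ 3 + m * h * g ^ 2, m * g ^ 2 + m * h * g;
          0, 0, m * g + m * h, 0;
          m ^ 2 * g - m * g, m ^ 2 - m, -2 * m * h * g - m * h ^ 2 - m ^ 2 * g ^ 2, m * g - m ^ 2 * g] ∧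
      (family₁ h g z hz).borderedRep (HopfAlgebra.antipode ℂ (gen h g .c)) = bordered 0
        ![0, 0, -m ^ 2, 0]
        !![0, 0, m ^ 2 - m, 0;
          0, 0, 0, 0;
          0, 0, 0, 0;
          0, 0, m ^ 2 - m, 0] ∧
      (family₁ h g z hz).borderedRep (HopfAlgebra.antipode ℂ (gen h g .d)) = bordered 1
        ![(m ^ 2 - m) / 2, 0, (-m * g - m * h - 3 * m ^ 2 * g - m ^ 2 * h) / 2, (-m - m ^ 2) / 2]
        !![(3 * m - m ^ 2) / 2, 0, (3 * m ^ 2 * g + m ^ 2 * h - 5 * m * g - m * h) / 2, (m ^ 2 - m) / 2;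
          m * g, m, -m * g ^ 2, -m * g;
          0, 0, m, 0;
          (m - m ^ 2) / 2, 0, (3 * m ^ 2 * g + m ^ 2 * h - m * g - m * h) / 2, (m + m ^ 2) / 2] := by
  have hz' : z + 1 ≠ 0 := right_ne_zero_of_mul_eq_one hm
  have hm' : m = (z + 1)⁻¹ := eq_inv_of_mul_eq_one_left hm
  subst hm'
  obtain ⟨ha, hb, hc, hd⟩ := borderedRep_antipode (family₁ h g z hz)
  rw [ha, hb, hc, hd]
  simp only [family₁, mul₄, add₄, sub₄, smul₄, neg₄, vecMul₄, rowAdd₄, rowSmul₄, rowNeg₄]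
  refine ⟨bordered_congr rfl ?_ ?_, bordered_congr rfl ?_ ?_, bordered_congr rfl ?_ ?_,
    bordered_congr rfl ?_ ?_⟩
  all_goals first | apply rowCongr₄ | apply congr₄
  all_goals
    try field_simp
    ring

lemma family₁_coaction (h g z m : ℂ) (hz : z ≠ -1)
    (hm : m * (z + 1) = 1) (i t : Fin 4) :
    (family₁ h g z hz).borderedRep (coactionMatrix h g i t) = bordered (if i = t then 1 else 0)
      (braidRow₁ (h + g) m i t) (braidMatrix₁ (h + g) m i t) := by
  obtain ⟨ha, hb, hc, hd⟩ := family₁_antipode h g z m hz hm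
  obtain ⟨ka, kb, kc, kd⟩ := borderedRep_gen (family₁ h g z hz)
  have hz' : z + 1 ≠ 0 := right_ne_zero_of_mul_eq_one hm
  have hm' : m = (z + 1)⁻¹ := eq_inv_of_mul_eq_one_left hm
  subst hm'
  fin_cases i <;> fin_cases t <;>
  · simp only [Fin.zero_eta, Fin.mk_one, Fin.reduceFinMk, Fin.isValue, coactionMatrix,
      Matrix.of_apply, Matrix.cons_val, map_mul, ha, hb, hc, hd, ka, kb, kc, kd, bordered_mul,
      braidRow₁, braidMatrix₁]
    simp only [family₁, mul₄, vecMul₄, rowAdd₄, rowSmul₄]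
    refine bordered_congr (by simp) ?_ ?_
    · apply rowCongr₄ <;> (try field_simp) <;> ring
    · apply congr₄ <;> (try field_simp) <;> ring

lemma family₂_antipode (h g z : ℂ) :
      (family₂ h g z).borderedRep (HopfAlgebra.antipode ℂ (gen h g .a)) = bordered 1
        ![(3 * z - 2) / 2, 0, (3 * z * g + 3 * z * h - 2 * h) / 2, 3 * z / 2]
        !![(2 - z) / 2, 0, (2 * h - z * g - z * h) / 2, -z / 2;
          z * g + z * h - h, 1, z * g ^ 2 + 2 * z * h * g + z * h ^ 2 - h ^ 2, h + z * g + z * h;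
          0, 0, 1, 0;
          z / 2, 0, (z * g + z * h - 2 * h) / 2, (2 + z) / 2] ∧
      (family₂ h g z).borderedRep (HopfAlgebra.antipode ℂ (gen h g .b)) = bordered 0
        ![-g, -1, g ^ 2, g]
        !![0, 0, 0, 0;
          -g ^ 2 - h * g, -g - h, g ^ 3 + h * g ^ 2, g ^ 2 + h * g;
          -z, 0, g + h - z * g - z * h, -z;
          z * g + z * h, 0, z * g ^ 2 + 2 * z * h * g + z * h ^ 2 - g ^ 2 - 2 * h * g - h ^ 2, z * g + z * h] ∧
      (family₂ h g z).borderedRep (HopfAlgebra.antipode ℂ (gen h g .c)) = bordered 0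
        ![0, 0, -1, 0]
        !![0, 0, 0, 0;
          -z, 0, -z * g - z * h, -z;
          0, 0, 0, 0;
          0, 0, 0, 0] ∧
      (family₂ h g z).borderedRep (HopfAlgebra.antipode ℂ (gen h g .d)) = bordered 1
        ![3 * z / 2, 0, (3 * z * g + 3 * z * h - 4 * g - 2 * h) / 2, (3 * z - 2) / 2]
        !![(2 + z) / 2, 0, (z * g + z * h - 2 * g) / 2, z / 2;
          g, 1, -g ^ 2, -g;
          0, 0, 1, 0;
          -z / 2, 0, (2 * g - z * g - z * h) / 2, (2 - z) / 2] := by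
  obtain ⟨ha, hb, hc, hd⟩ := borderedRep_antipode (family₂ h g z)
  rw [ha, hb, hc, hd]
  simp only [family₂, mul₄, add₄, sub₄, smul₄, neg₄, vecMul₄, rowAdd₄, rowNeg₄]
  refine ⟨bordered_congr rfl ?_ ?_, bordered_congr rfl ?_ ?_, bordered_congr rfl ?_ ?_,
    bordered_congr rfl ?_ ?_⟩
  all_goals first | apply rowCongr₄ | apply congr₄
  all_goals ring

lemma family₂_coaction (h g z : ℂ) (i t : Fin 4) :
    (family₂ h g z).borderedRep (coactionMatrix h g i t) = bordered (if i = t then 1 else 0)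
      (braidRow₂ (h + g) z i t) (braidMatrix₂ (h + g) z i t) := by
  obtain ⟨ha, hb, hc, hd⟩ := family₂_antipode h g z
  obtain ⟨ka, kb, kc, kd⟩ := borderedRep_gen (family₂ h g z)
  fin_cases i <;> fin_cases t <;>
  · simp only [Fin.zero_eta, Fin.mk_one, Fin.reduceFinMk, Fin.isValue, coactionMatrix,
      Matrix.of_apply, Matrix.cons_val, map_mul, ha, hb, hc, hd, ka, kb, kc, kd, bordered_mul,
      braidRow₂, braidMatrix₂]
    simp only [family₂, mul₄, vecMul₄, rowAdd₄, rowSmul₄]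
    refine bordered_congr (by simp) ?_ ?_
    · apply rowCongr₄ <;> ring
    · apply congr₄ <;> ring

lemma family₃_antipode (h g z m : ℂ) (hz : z ≠ -1)
    (hm : m * (z + 1) = 1) :
      (family₃ h g z hz).borderedRep (HopfAlgebra.antipode ℂ (gen h g .a)) = bordered 1
        ![(-1 - m) / 2, 0, (g - h - m * g - m * h) / 2, (1 - m) / 2]
        !![(1 + m) / 2, 0, (h + m * g + m * h - g) / 2, (m - 1) / 2;
          -h, 1, -h ^ 2, h;
          0, 0, 1, 0;
          (m - 1) / 2, 0, (m * g + m * h - g - 3 * h) / 2, (1 + m) / 2] ∧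
      (family₃ h g z hz).borderedRep (HopfAlgebra.antipode ℂ (gen h g .b)) = bordered 0
        ![-g, -1, g ^ 2, g]
        !![0, 0, 0, 0;
          -g ^ 2 - h * g, -g - h, g ^ 3 + h * g ^ 2, g ^ 2 + h * g;
          0, 0, g + h, 0;
          0, 0, -g ^ 2 - 2 * h * g - h ^ 2, 0] ∧
      (family₃ h g z hz).borderedRep (HopfAlgebra.antipode ℂ (gen h g .c)) = bordered 0
        ![0, 0, -1, 0]
        !![0, 0, 0, 0;
          0, 0, 0, 0;
          0, 0, 0, 0;
          0, 0, 0, 0] ∧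
      (family₃ h g z hz).borderedRep (HopfAlgebra.antipode ℂ (gen h g .d)) = bordered 1
        ![(1 - m) / 2, 0, (-3 * g - h - m * g - m * h) / 2, (-1 - m) / 2]
        !![(1 + m) / 2, 0, (m * g + m * h - 3 * g - h) / 2, (m - 1) / 2;
          g, 1, -g ^ 2, -g;
          0, 0, 1, 0;
          (m - 1) / 2, 0, (g + m * g + m * h - h) / 2, (1 + m) / 2] := by
  have hz' : z + 1 ≠ 0 := right_ne_zero_of_mul_eq_one hm
  have hm' : m = (z + 1)⁻¹ := eq_inv_of_mul_eq_one_left hm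
  subst hm'
  obtain ⟨ha, hb, hc, hd⟩ := borderedRep_antipode (family₃ h g z hz)
  rw [ha, hb, hc, hd]
  simp only [family₃, mul₄, add₄, sub₄, smul₄, neg₄, vecMul₄, rowAdd₄, rowSmul₄, rowNeg₄]
  refine ⟨bordered_congr rfl ?_ ?_, bordered_congr rfl ?_ ?_, bordered_congr rfl ?_ ?_,
    bordered_congr rfl ?_ ?_⟩
  all_goals first | apply rowCongr₄ | apply congr₄
  all_goals
    try field_simp
    ring

/-- The parameter z cancels. Let N be the matrix whose first and fourth rows are (1, 0, h + g, 1),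
the others being zero, and K = 1 + (z/2)N. Then K commutes with the values of A, B, C, D at z = 0,
and A, B, C, D are these values times K. The images of S(T), and their χ rows, thus carry K⁻¹, and
the products S(T_{pr}) T_{sq} do not see z. At z = 0 this calculus coincides with the first one,
whence m = 1. -/
lemma family₃_coaction (h g z : ℂ) (hz : z ≠ -1) (i t : Fin 4) :
    (family₃ h g z hz).borderedRep (coactionMatrix h g i t) = bordered (if i = t then 1 else 0)
      (braidRow₁ (h + g) 1 i t) (braidMatrix₁ (h + g) 1 i t) := by
  have hz1 : z + 1 ≠ 0 := fun H => hz (by linear_combination H)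
  obtain ⟨ha, hb, hc, hd⟩ := family₃_antipode h g z _ hz (inv_mul_cancel₀ hz1)
  obtain ⟨ka, kb, kc, kd⟩ := borderedRep_gen (family₃ h g z hz)
  fin_cases i <;> fin_cases t <;>
  · simp only [Fin.zero_eta, Fin.mk_one, Fin.reduceFinMk, Fin.isValue, coactionMatrix,
      Matrix.of_apply, Matrix.cons_val, map_mul, ha, hb, hc, hd, ka, kb, kc, kd, bordered_mul,
      braidRow₁, braidMatrix₁]
    simp only [family₃, mul₄, vecMul₄, rowAdd₄, rowSmul₄]
    refine bordered_congr (by simp) ?_ ?_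
    · apply rowCongr₄ <;> (try field_simp) <;> ring
    · apply congr₄ <;> (try field_simp) <;> ring

theorem family₁_isEnveloping_iff (h g z : ℂ) (hz : z ≠ -1) {B : Type*} [Ring B] [Algebra ℂ B]
    (x : Fin 4 → B) : (family₁ h g z hz).IsEnveloping x ↔
      LieRelations (h + g) (z + 1)⁻¹ (x 0) (x 1) (x 2) (x 3) :=
  (isEnveloping_iff_of_borderedRep _ (family₁_coaction h g z _ hz
    (inv_mul_cancel₀ fun H => hz (by linear_combination H))) x).trans (braid₁_iff _ _ x)

theorem family₂_isEnveloping_iff (h g z : ℂ) {B : Type*} [Ring B] [Algebra ℂ B]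
    (x : Fin 4 → B) : (family₂ h g z).IsEnveloping x ↔
      LieRelations (h + g) 1 (x 0) (x 1) (x 2) (x 3) :=
  (isEnveloping_iff_of_borderedRep _ (family₂_coaction h g z) x).trans (braid₂_iff _ _ x)

theorem family₃_isEnveloping_iff (h g z : ℂ) (hz : z ≠ -1) {B : Type*} [Ring B] [Algebra ℂ B]
    (x : Fin 4 → B) : (family₃ h g z hz).IsEnveloping x ↔
      LieRelations (h + g) 1 (x 0) (x 1) (x 2) (x 3) :=
  (isEnveloping_iff_of_borderedRep _ (family₃_coaction h g z hz) x).trans (braid₁_iff _ _ x)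

end

end Jordanian

end

/-! ### Presentations and bases for the three families -/

theorem mainTheorem5 (h g : ℂ) :
    (∀ (z : ℂ) (hz : z ≠ -1),
      Jordanian.EnvelopingRelations₁ h g z
        ((Jordanian.family₁ h g z hz).χ 0) ((Jordanian.family₁ h g z hz).χ 1)
        ((Jordanian.family₁ h g z hz).χ 2) ((Jordanian.family₁ h g z hz).χ 3) ∧
      (∀ (B : Type*) [Ring B] [Algebra ℂ B] (x₁ x₂ x₃ x₄ : B),
        Jordanian.EnvelopingRelations₁ h g z x₁ x₂ x₃ x₄ →
          ∃! φ : (Jordanian.family₁ h g z hz).Enveloping →ₐ[ℂ] B,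
            φ ((Jordanian.family₁ h g z hz).χ 0) = x₁ ∧
            φ ((Jordanian.family₁ h g z hz).χ 1) = x₂ ∧
            φ ((Jordanian.family₁ h g z hz).χ 2) = x₃ ∧
            φ ((Jordanian.family₁ h g z hz).χ 3) = x₄) ∧
      ∃ b : Module.Basis (ℕ × ℕ × ℕ × ℕ) ℂ (Jordanian.family₁ h g z hz).Enveloping,
        ∀ m, b m = Jordanian.orderedMonomial
          ((Jordanian.family₁ h g z hz).χ 0) ((Jordanian.family₁ h g z hz).χ 1)
          ((Jordanian.family₁ h g z hz).χ 2) ((Jordanian.family₁ h g z hz).χ 3) m) ∧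
    (∀ z : ℂ,
      Jordanian.EnvelopingRelations₂₃ h g
        ((Jordanian.family₂ h g z).χ 0) ((Jordanian.family₂ h g z).χ 1)
        ((Jordanian.family₂ h g z).χ 2) ((Jordanian.family₂ h g z).χ 3) ∧
      (∀ (B : Type*) [Ring B] [Algebra ℂ B] (x₁ x₂ x₃ x₄ : B),
        Jordanian.EnvelopingRelations₂₃ h g x₁ x₂ x₃ x₄ →
          ∃! φ : (Jordanian.family₂ h g z).Enveloping →ₐ[ℂ] B,
            φ ((Jordanian.family₂ h g z).χ 0) = x₁ ∧
            φ ((Jordanian.family₂ h g z).χ 1) = x₂ ∧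
            φ ((Jordanian.family₂ h g z).χ 2) = x₃ ∧
            φ ((Jordanian.family₂ h g z).χ 3) = x₄) ∧
      ∃ b : Module.Basis (ℕ × ℕ × ℕ × ℕ) ℂ (Jordanian.family₂ h g z).Enveloping,
        ∀ m, b m = Jordanian.orderedMonomial
          ((Jordanian.family₂ h g z).χ 0) ((Jordanian.family₂ h g z).χ 1)
          ((Jordanian.family₂ h g z).χ 2) ((Jordanian.family₂ h g z).χ 3) m) ∧
    (∀ (z : ℂ) (hz : z ≠ -1),
      Jordanian.EnvelopingRelations₂₃ h g
        ((Jordanian.family₃ h g z hz).χ 0) ((Jordanian.family₃ h g z hz).χ 1)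
        ((Jordanian.family₃ h g z hz).χ 2) ((Jordanian.family₃ h g z hz).χ 3) ∧
      (∀ (B : Type*) [Ring B] [Algebra ℂ B] (x₁ x₂ x₃ x₄ : B),
        Jordanian.EnvelopingRelations₂₃ h g x₁ x₂ x₃ x₄ →
          ∃! φ : (Jordanian.family₃ h g z hz).Enveloping →ₐ[ℂ] B,
            φ ((Jordanian.family₃ h g z hz).χ 0) = x₁ ∧
            φ ((Jordanian.family₃ h g z hz).χ 1) = x₂ ∧
            φ ((Jordanian.family₃ h g z hz).χ 2) = x₃ ∧
            φ ((Jordanian.family₃ h g z hz).χ 3) = x₄) ∧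
      ∃ b : Module.Basis (ℕ × ℕ × ℕ × ℕ) ℂ (Jordanian.family₃ h g z hz).Enveloping,
        ∀ m, b m = Jordanian.orderedMonomial
          ((Jordanian.family₃ h g z hz).χ 0) ((Jordanian.family₃ h g z hz).χ 1)
          ((Jordanian.family₃ h g z hz).χ 2) ((Jordanian.family₃ h g z hz).χ 3) m) ∧
    (∀ (B : Type*) [Ring B] [Algebra ℂ B] (x₁ x₂ x₃ x₄ : B),
      Jordanian.EnvelopingRelations₁ h g 0 x₁ x₂ x₃ x₄ ↔
        Jordanian.EnvelopingRelations₂₃ h g x₁ x₂ x₃ x₄) := by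
  refine ⟨fun z hz => ?_, fun z => ?_, fun z hz => ?_, fun B _ _ x₁ x₂ x₃ x₄ => ?_⟩
  · refine ⟨(Jordanian.envelopingRelations₁_iff hz).mpr
      ((Jordanian.family₁_isEnveloping_iff h g z hz _).mp
        (Jordanian.family₁ h g z hz).isEnveloping_χ), fun B _ _ x₁ x₂ x₃ x₄ H => ?_, ?_⟩
    · exact (Jordanian.family₁ h g z hz).existsUnique_lift_of_iff
        (Jordanian.family₁_isEnveloping_iff h g z hz)
        ((Jordanian.envelopingRelations₁_iff hz).mp H)
    · exact (Jordanian.family₁ h g z hz).exists_basis_of_iff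
        (Jordanian.family₁_isEnveloping_iff h g z hz)
  · refine ⟨Jordanian.envelopingRelations₂₃_iff.mpr
      ((Jordanian.family₂_isEnveloping_iff h g z _).mp
        (Jordanian.family₂ h g z).isEnveloping_χ), fun B _ _ x₁ x₂ x₃ x₄ H => ?_, ?_⟩
    · exact (Jordanian.family₂ h g z).existsUnique_lift_of_iff
        (Jordanian.family₂_isEnveloping_iff h g z) (Jordanian.envelopingRelations₂₃_iff.mp H)
    · exact (Jordanian.family₂ h g z).exists_basis_of_iff
        (Jordanian.family₂_isEnveloping_iff h g z)
  · refine ⟨Jordanian.envelopingRelations₂₃_iff.mpr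
      ((Jordanian.family₃_isEnveloping_iff h g z hz _).mp
        (Jordanian.family₃ h g z hz).isEnveloping_χ), fun B _ _ x₁ x₂ x₃ x₄ H => ?_, ?_⟩
    · exact (Jordanian.family₃ h g z hz).existsUnique_lift_of_iff
        (Jordanian.family₃_isEnveloping_iff h g z hz) (Jordanian.envelopingRelations₂₃_iff.mp H)
    · exact (Jordanian.family₃ h g z hz).exists_basis_of_iff
        (Jordanian.family₃_isEnveloping_iff h g z hz)
  -- At z = 0 the parameter m = (z + 1)⁻¹ equals 1, and both sides are the same `LieRelations`.
  · rw [Jordanian.envelopingRelations₁_iff (by norm_num), Jordanian.envelopingRelations₂₃_iff,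
      zero_add, inv_one]
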